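/- Let $\lambda,\mu,\mu^*\in\mathbb R$ with $\mu>0$, $\lambda+\mu>0$, $\mu^*>0$ and $\mu^*\neq\mu$. For $F=(F_1,F_2)\in\mathbb R^2$ call $u=(u_1,u_2):\mathbb R^2\to\mathbb R^2$ a displacement field of the infinite plane-strain cubic body under the concentrated force $F\delta$ if $u$ is locally integrable on $\mathbb R^2$, is $C^1$ on $\mathbb R^2\setminus\{0\}$, satisfies in the sense of distributions on $\mathbb R^2$ $$(\lambda+2\mu)\,u_{1,x_1x_1}+\mu^*u_{1,x_2x_2}+(\lambda+\mu^*)\,u_{2,x_1x_2}+F_1\,\delta=0,$$ $$(\lambda+2\mu)\,u_{2,x_2x_2}+\mu^*u_{2,x_1x_1}+(\lambda+\mu^*)\,u_{1,x_1x_2}+F_2\,\delta=0,$$ where $\delta$ is the Dirac mass at the origin, and its strain $\tfrac12(u_{k,x_l}+u_{l,x_k})$ tends to $0$ as $|x|\to\infty$. Put $$p=2\lambda\mu^*-4\mu(\lambda+\mu),\qquad q=16\mu(\mu-\mu^*)(\lambda+\mu)(\lambda+\mu+\mu^*),\qquad s_{1,2}=\frac{\sqrt{-p\mp\sqrt q}}{\sqrt{2\mu^*(\lambda+2\mu)}},$$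 $$Y_m^{(1)}=\frac{(\lambda+2\mu)s_m^2-\mu^*}{s_m},\qquad Y_m^{(2)}=\frac{\mu^*s_m^2-(\lambda+2\mu)}{s_m},\qquad r_m=\sqrt{x_1^2+s_m^2x_2^2},\qquad \theta_m=\arctan\frac{s_mx_2}{x_1}\qquad(m=1,2),$$ where square roots, logarithms and arctangents are the principal complex ones (if $\mu^*<\mu$ then $q>0$ and all quantities are real; if $\mu^*>\mu$ then $q<0$ and $s_1,s_2$ are complex conjugates), and $\theta_2-\theta_1$ is extended by $0$ to the line $x_1=0$. For $P_1,P_2\in\mathbb R$ define $$u_1^{(P_1)}=\frac{P_1}{2\pi\sqrt q}\bigl(Y_1^{(1)}\log r_1-Y_2^{(1)}\log r_2\bigr),\qquad u_2^{(P_1)}=\frac{P_1(\lambda+\mu^*)}{2\pi\sqrt q}(\theta_2-\theta_1),$$ $$u_1^{(P_2)}=\frac{P_2(\lambda+\mu^*)}{2\pi\sqrt q}(\theta_2-\theta_1),\qquad u_2^{(P_2)}=\frac{P_2}{2\pi\sqrt q}\bigl(Y_1^{(2)}\log r_1-Y_2^{(2)}\log r_2\bigr).$$ Then $u^{(P_1)}$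 and $u^{(P_2)}$ are real valued on $\mathbb R^2\setminus\{0\}$; $u^{(P_1)}$ is a displacement field of the infinite body under the horizontal concentrated force $(P_1,0)\delta$, and $u^{(P_2)}$ one under the vertical concentrated force $(0,P_2)\delta$. Moreover, the displacement fields of the infinite body under $(P_1,0)\delta$ (respectively $(0,P_2)\delta$) are exactly the fields that agree on $\mathbb R^2\setminus\{0\}$ with $u^{(P_1)}$ (respectively $u^{(P_2)}$) plus a rigid-body displacement $(c_1-\omega x_2,\;c_2+\omega x_1)$, where $c_1,c_2,\omega\in\mathbb R$. -/

import Mathlib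

open MeasureTheory Filter Topology
open scoped ContDiff

noncomputable section

namespace CubicGreen

/-- The partial derivatives `∂f/∂x₁` (index `0`) and `∂f/∂x₂` (index `1`) of a function on the
plane. -/
def pd (i : Fin 2) (f : ℝ × ℝ → ℝ) (x : ℝ × ℝ) : ℝ :=
  fderiv ℝ f x (if i = 0 then (1, 0) else (0, 1))

/-- A plane displacement field `(u₁, u₂)`; the components carry the indices `0` and `1`. -/
abbrev Displacement : Type := Fin 2 → ℝ × ℝ → ℝ

/-- The linearized strain `ε_{kl} = (u_{k,x_l} + u_{l,x_k}) / 2`. -/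
def strain (u : Displacement) (k l : Fin 2) (x : ℝ × ℝ) : ℝ :=
  (pd l (u k) x + pd k (u l) x) / 2

/-- `u` satisfies, in the sense of distributions on the whole plane, the plane strain equilibrium
equations of a cubic material loaded by the concentrated body force `f_k = F_k δ(x₁) δ(x₂)`:

`(λ + 2μ) u_{1,11} + μ* u_{1,22} + (λ + μ*) u_{2,12} + F₁ δ = 0`,
`(λ + 2μ) u_{2,22} + μ* u_{2,11} + (λ + μ*) u_{1,12} + F₂ δ = 0`. -/
def SolvesEquilibrium (lam mu mus : ℝ) (F : Fin 2 → ℝ) (u : Displacement) : Prop :=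
  ∀ φ : ℝ × ℝ → ℝ, ContDiff ℝ ∞ φ → HasCompactSupport φ →
    (∫ x : ℝ × ℝ,
        (u 0 x * ((lam + 2 * mu) * pd 0 (pd 0 φ) x + mus * pd 1 (pd 1 φ) x)
          + u 1 x * ((lam + mus) * pd 0 (pd 1 φ) x))) + F 0 * φ 0 = 0 ∧
    (∫ x : ℝ × ℝ,
        (u 1 x * ((lam + 2 * mu) * pd 1 (pd 1 φ) x + mus * pd 0 (pd 0 φ) x)
          + u 0 x * ((lam + mus) * pd 0 (pd 1 φ) x))) + F 1 * φ 0 = 0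

/-- `u` is a displacement field of the infinite body under the concentrated force `F` acting at the
origin: it is locally integrable, continuously differentiable away from the origin, solves the
equilibrium equations, and its strain vanishes at infinity. -/
structure IsPointForceDisplacement (lam mu mus : ℝ) (F : Fin 2 → ℝ) (u : Displacement) : Prop where
  locallyIntegrable : ∀ k, LocallyIntegrable (u k) volume
  contDiffOn : ∀ k, ContDiffOn ℝ 1 (u k) {0}ᶜ
  equilibrium : SolvesEquilibrium lam mu mus F u
  strain_tendsto : ∀ k l, Tendsto (strain u k l) (cocompact (ℝ × ℝ)) (𝓝 0)

/-- The rigid-body displacement with translation `c` and infinitesimal rotation `rot`. -/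
def rigid (c : Fin 2 → ℝ) (rot : ℝ) : Displacement :=
  ![fun x => c 0 - rot * x.2, fun x => c 1 + rot * x.1]

/-- The principal complex square root. -/
def csqrt (z : ℂ) : ℂ := z ^ (1 / 2 : ℂ)

/-- `p = 2 λ μ* - 4 μ (λ + μ)`. -/
def p (lam mu mus : ℝ) : ℝ := 2 * lam * mus - 4 * mu * (lam + mu)

/-- `q = 16 μ (μ - μ*) (λ + μ) (λ + μ + μ*)`. -/
def q (lam mu mus : ℝ) : ℝ := 16 * mu * (mu - mus) * (lam + mu) * (lam + mu + mus)

/-- `√q`, which is purely imaginary when `μ* > μ`. -/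
def sqrtq (lam mu mus : ℝ) : ℂ := csqrt (q lam mu mus : ℂ)

/-- `s₁` (index `0`, sign `-`) and `s₂` (index `1`, sign `+`):
`s_{1,2} = √(-p ∓ √q) / √(2 μ* (λ + 2μ))`. -/
def s (lam mu mus : ℝ) (m : Fin 2) : ℂ :=
  1 / csqrt ((2 * mus * (lam + 2 * mu) : ℝ) : ℂ) *
    csqrt (if m = 0 then -(p lam mu mus : ℂ) - sqrtq lam mu mus
      else -(p lam mu mus : ℂ) + sqrtq lam mu mus)

/-- `Y_m^{(1)} = ((λ + 2μ) s_m² - μ*) / s_m`. -/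
def Y1 (lam mu mus : ℝ) (m : Fin 2) : ℂ :=
  (((lam + 2 * mu : ℝ) : ℂ) * s lam mu mus m ^ 2 - (mus : ℂ)) / s lam mu mus m

/-- `Y_m^{(2)} = (μ* s_m² - (λ + 2μ)) / s_m`. -/
def Y2 (lam mu mus : ℝ) (m : Fin 2) : ℂ :=
  ((mus : ℂ) * s lam mu mus m ^ 2 - ((lam + 2 * mu : ℝ) : ℂ)) / s lam mu mus m

/-- `r_m = √(x₁² + s_m² x₂²)`. -/
def r (lam mu mus : ℝ) (m : Fin 2) (x : ℝ × ℝ) : ℂ :=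
  csqrt ((x.1 : ℂ) ^ 2 + s lam mu mus m ^ 2 * (x.2 : ℂ) ^ 2)

/-- `θ_m = arctan (s_m x₂ / x₁)`. On the line `x₁ = 0` both angles get the value `0`; only the
difference `θ₂ - θ₁` is used, whose continuous extension to that line, away from the origin,
is `0` as well. -/
def θ (lam mu mus : ℝ) (m : Fin 2) (x : ℝ × ℝ) : ℂ :=
  Complex.arctan (s lam mu mus m * (x.2 : ℂ) / (x.1 : ℂ))

/-- The closed-form field `u^{(P₁)}` of a horizontal point force `P`. -/
def uP1 (lam mu mus P : ℝ) : Fin 2 → ℝ × ℝ → ℂ :=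
  ![fun x => (P : ℂ) / (2 * (Real.pi : ℂ) * sqrtq lam mu mus) *
      (Y1 lam mu mus 0 * Complex.log (r lam mu mus 0 x)
        - Y1 lam mu mus 1 * Complex.log (r lam mu mus 1 x)),
    fun x => (P : ℂ) * ((lam + mus : ℝ) : ℂ) / (2 * (Real.pi : ℂ) * sqrtq lam mu mus) *
      (θ lam mu mus 1 x - θ lam mu mus 0 x)]

/-- The closed-form field `u^{(P₂)}` of a vertical point force `P`. -/
def uP2 (lam mu mus P : ℝ) : Fin 2 → ℝ × ℝ → ℂ :=
  ![fun x => (P : ℂ) * ((lam + mus : ℝ) : ℂ) / (2 * (Real.pi : ℂ) * sqrtq lam mu mus) *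
      (θ lam mu mus 1 x - θ lam mu mus 0 x),
    fun x => (P : ℂ) / (2 * (Real.pi : ℂ) * sqrtq lam mu mus) *
      (Y2 lam mu mus 0 * Complex.log (r lam mu mus 0 x)
        - Y2 lam mu mus 1 * Complex.log (r lam mu mus 1 x))]

/-- The real displacement field given by a closed-form expression (which is to be real valued). -/
def realField (w : Fin 2 → ℝ × ℝ → ℂ) : Displacement := fun k x => (w k x).re

end CubicGreen

end

/-!
Write `A = λ + 2μ`, `B = μ*`, `C = λ + μ*`. The determinant of the symbol of the equilibrium
operator is `A B (ξ₂² + s₁² ξ₁²) (ξ₂² + s₂² ξ₁²)`: the squares `s_m²` are the roots of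
`A B z² + p z + A B`, of discriminant `q`, and they are real and positive or complex conjugate
according to the sign of `q`; in all cases `Re s_m > 0` (`Admissible.s_sq`, `Admissible.s_re_pos`).

*Existence.* With `Λ_m = log (x₁² + s_m² x₂²) = 2 log r_m`, one has
`(∂₂² + s_m² ∂₁²) Λ_m = 4 π s_m δ` in the sense of distributions (`pairing_log_quadForm`). Indeed one
integration by parts turns the pairing with `ψ` into the integral of the radial derivative of `ψ`
against a function of the polar angle alone, so only `∫ dt / (cos² t + s² sin² t) = 2 π / s` is needed.
The difference `θ₂ - θ₁` continues smoothly across `x₁ = 0`, as a difference of logarithms of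
quotients of linear forms (`angleDiff_eq_arctan_sub`), and its first derivatives are combinations of
those of the `Λ_m` (`isLogType_angleDiff`). The equilibrium equations then reduce to the equation for
`s_m²`, and the point masses of `Λ₁` and `Λ₂` add up to the prescribed one since
`A B (s₁² - s₂²) = -√q`. Only one integration by parts across the origin is used at a time; it is
justified by Fubini on the lines that avoid the origin (`integral_partial_eq_zero`). The fields are
real valued because complex conjugation fixes `s₁`, `s₂`, `√q` if `q > 0`, and interchanges `s₁` with
`s₂` and changes the sign of `√q` if `q < 0`.

*Uniqueness.* Let `u` be the difference of two solutions, and convolve it with a test function. The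
strain of the convolution is smooth, tends to zero at infinity together with all its derivatives,
which are strains of convolutions with other test functions, and is annihilated by the product of
the four first order operators `∂₂ ± i s_m ∂₁`. Each of them is a Cauchy-Riemann operator
in suitable real-linear coordinates, so Liouville's theorem removes them one after the other
(`IsDecayingFamily.eq_zero`). Hence the convolutions have no strain and are rigid displacements, and
so is their limit `u` (`IsPointForceDisplacement.eq_rigid`).
-/

namespace CubicGreen

/-! ### Complex test functions and pairings -/

/-- The coordinate direction of the partial derivative `pd i`. -/
def basisVec (i : Fin 2) : ℝ × ℝ := if i = 0 then (1, 0) else (0, 1)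

/-- The space of complex-valued smooth compactly supported functions on the plane. -/
def testSubmodule : Submodule ℂ (ℝ × ℝ → ℂ) where
  carrier := {ψ | ContDiff ℝ ∞ ψ ∧ HasCompactSupport ψ}
  add_mem' h₁ h₂ := ⟨h₁.1.add h₂.1, h₁.2.add h₂.2⟩
  zero_mem' := ⟨contDiff_const, HasCompactSupport.zero⟩
  smul_mem' c _ h := ⟨contDiff_const.smul h.1, h.2.smul_left (f := fun _ => c)⟩

/-- A smooth compactly supported function from the plane to the complex numbers. -/
abbrev TestFun : Type := testSubmodule

namespace TestFun

theorem contDiff (ψ : TestFun) : ContDiff ℝ ∞ (ψ : ℝ × ℝ → ℂ) := ψ.2.1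

theorem hasCompactSupport (ψ : TestFun) : HasCompactSupport (ψ : ℝ × ℝ → ℂ) := ψ.2.2

theorem differentiable (ψ : TestFun) : Differentiable ℝ (ψ : ℝ × ℝ → ℂ) :=
  ψ.contDiff.differentiable (by simp)

theorem continuous (ψ : TestFun) : Continuous (ψ : ℝ × ℝ → ℂ) := ψ.contDiff.continuous

/-- The partial derivative in direction `basisVec i`, as an operator on test functions. -/
noncomputable def d (i : Fin 2) : TestFun →ₗ[ℂ] TestFun where
  toFun ψ := ⟨fun x => fderiv ℝ (ψ : ℝ × ℝ → ℂ) x (basisVec i),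
    (ψ.contDiff.fderiv_right (m := ∞) (by simp)).clm_apply contDiff_const,
    ψ.hasCompactSupport.fderiv_apply (𝕜 := ℝ) (basisVec i)⟩
  map_add' ψ χ := by
    ext x
    simp [fderiv_add (ψ.differentiable x) (χ.differentiable x)]
  map_smul' c ψ := by
    ext x
    simp [fderiv_const_smul (ψ.differentiable x)]

theorem d_apply (i : Fin 2) (ψ : TestFun) (x : ℝ × ℝ) :
    (d i ψ).1 x = fderiv ℝ (ψ : ℝ × ℝ → ℂ) x (basisVec i) := rfl

theorem d_comm (i j : Fin 2) (ψ : TestFun) : d i (d j ψ) = d j (d i ψ) := by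
  have key : ∀ (i j : Fin 2) (x : ℝ × ℝ), (d i (d j ψ)).1 x =
      fderiv ℝ (fderiv ℝ (ψ : ℝ × ℝ → ℂ)) x (basisVec i) (basisVec j) := by
    intro i j x
    have h : DifferentiableAt ℝ (fderiv ℝ (ψ : ℝ × ℝ → ℂ)) x :=
      (ψ.contDiff.fderiv_right (m := ∞) (by simp)).differentiable (by simp) x
    have h2 := (h.hasFDerivAt.clm_apply (hasFDerivAt_const (basisVec j) x)).fderiv
    rw [d_apply]
    change fderiv ℝ (fun y => fderiv ℝ (ψ : ℝ × ℝ → ℂ) y (basisVec j)) x (basisVec i) = _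
    rw [h2]
    simp
  ext x
  rw [key, key]
  have hs : IsSymmSndFDerivAt ℝ (ψ : ℝ × ℝ → ℂ) x :=
    ψ.contDiff.contDiffAt.isSymmSndFDerivAt (by
      rw [minSmoothness_of_isRCLikeNormedField]; exact WithTop.coe_le_coe.2 le_top)
  exact hs.eq _ _

/-- A real test function, viewed as a complex one. -/
noncomputable def ofReal (φ : ℝ × ℝ → ℝ) (h : ContDiff ℝ ∞ φ) (hc : HasCompactSupport φ) :
    TestFun :=
  ⟨fun x => (φ x : ℂ), Complex.ofRealCLM.contDiff.comp h,
    hc.comp_left (g := ((↑) : ℝ → ℂ)) Complex.ofReal_zero⟩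

theorem ofReal_apply (φ : ℝ × ℝ → ℝ) (h : ContDiff ℝ ∞ φ) (hc : HasCompactSupport φ) (x : ℝ × ℝ) :
    (ofReal φ h hc).1 x = (φ x : ℂ) := rfl

/-- The reflected translate `y ↦ ψ (x - y)`. -/
noncomputable def refl (x : ℝ × ℝ) : TestFun →ₗ[ℂ] TestFun where
  toFun ψ := ⟨fun y => ψ.1 (x - y), ψ.contDiff.comp (contDiff_const.sub contDiff_id),
    ψ.hasCompactSupport.comp_homeomorph (Homeomorph.subLeft x)⟩
  map_add' _ _ := rfl
  map_smul' _ _ := rfl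

theorem refl_apply (x y : ℝ × ℝ) (ψ : TestFun) : (refl x ψ).1 y = ψ.1 (x - y) := rfl

theorem d_refl (i : Fin 2) (x : ℝ × ℝ) (ψ : TestFun) :
    d i (refl x ψ) = -refl x (d i ψ) := by
  ext y
  have h : HasFDerivAt (fun y => ψ.1 (x - y))
      ((fderiv ℝ ψ.1 (x - y)).comp (-ContinuousLinearMap.id ℝ (ℝ × ℝ))) y :=
    (ψ.differentiable (x - y)).hasFDerivAt.comp y ((hasFDerivAt_id y).const_sub x)
  rw [d_apply]
  change fderiv ℝ (fun y => ψ.1 (x - y)) y (basisVec i) = -(fderiv ℝ ψ.1 (x - y) (basisVec i))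
  rw [h.fderiv]
  simp

end TestFun

theorem integrable_mul_testFun {f : ℝ × ℝ → ℂ} (hf : LocallyIntegrable f) (ψ : TestFun) :
    Integrable fun x => f x * ψ.1 x := by
  simpa [smul_eq_mul] using
    hf.integrable_smul_right_of_hasCompactSupport ψ.continuous ψ.hasCompactSupport

/-- The functional `ψ ↦ ∫ f ψ` on test functions that is given by a locally integrable `f`. -/
noncomputable def pairing (f : ℝ × ℝ → ℂ) (hf : LocallyIntegrable f) : TestFun →ₗ[ℂ] ℂ where
  toFun ψ := ∫ x, f x * ψ.1 x
  map_add' ψ χ := by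
    rw [← integral_add (integrable_mul_testFun hf ψ) (integrable_mul_testFun hf χ)]
    refine integral_congr_ae (Eventually.of_forall fun x => ?_)
    simp [mul_add]
  map_smul' c ψ := by
    simp only [RingHom.id_apply, smul_eq_mul]
    rw [← integral_const_mul]
    refine integral_congr_ae (Eventually.of_forall fun x => ?_)
    simp [mul_left_comm]

theorem pairing_apply {f : ℝ × ℝ → ℂ} (hf : LocallyIntegrable f) (ψ : TestFun) :
    pairing f hf ψ = ∫ x, f x * ψ.1 x := rfl

/-! ### Integration by parts across a point singularity -/

/-- By Fubini, only the lines that miss the origin matter, so a point singularity does not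
contribute as long as the derivative is integrable. -/
theorem integral_partial_eq_zero {g : ℝ × ℝ → ℂ} {g' : ℝ × ℝ → (ℝ × ℝ →L[ℝ] ℂ)} (i : Fin 2)
    (hg : ∀ x ≠ 0, HasFDerivAt g (g' x) x) (hc : HasCompactSupport g)
    (hi : Integrable fun x => g' x (basisVec i)) : ∫ x, g' x (basisVec i) = 0 := by
  have h0 : ∀ᵐ t : ℝ, t ≠ 0 := by simp [ae_iff]
  have hline : ∀ (L : ℝ → ℝ × ℝ), (∀ t, L t ≠ 0) → (∀ t, HasDerivAt L (basisVec i) t) →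
      IsClosedEmbedding L → Integrable (fun t => g' (L t) (basisVec i)) →
      ∫ t, g' (L t) (basisVec i) = 0 := by
    intro L hL0 hL hemb hint
    have hd : ∀ t, HasDerivAt (fun t => g (L t)) (g' (L t) (basisVec i)) t :=
      fun t => (hg _ (hL0 t)).comp_hasDerivAt t (hL t)
    refine integral_eq_zero_of_hasDerivAt_of_integrable hd hint ?_
    exact (continuous_iff_continuousAt.2
      fun t => (hd t).continuousAt).integrable_of_hasCompactSupport (hc.comp_isClosedEmbedding hemb)
  rw [Measure.volume_eq_prod] at hi ⊢
  fin_cases i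
  · rw [integral_prod_symm _ hi]
    refine integral_eq_zero_of_ae ?_
    filter_upwards [hi.prod_left_ae, h0] with b hb hb0
    refine hline (fun t => (t, b)) (fun t h => hb0 (by simpa using congrArg Prod.snd h))
      (fun t => ?_) ?_ hb
    · simpa [basisVec] using (hasDerivAt_id t).prodMk (hasDerivAt_const t b)
    · refine Topology.IsClosedEmbedding.of_continuous_injective_isClosedMap (by fun_prop)
        (fun s t h => by simpa using h) (isClosedMap_prodMk_right b)
  · rw [integral_prod _ hi]
    refine integral_eq_zero_of_ae ?_
    filter_upwards [hi.prod_right_ae, h0] with b hb hb0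
    refine hline (fun t => (b, t)) (fun t h => hb0 (by simpa using congrArg Prod.fst h))
      (fun t => ?_) ?_ hb
    · simpa [basisVec] using (hasDerivAt_const t b).prodMk (hasDerivAt_id t)
    · refine Topology.IsClosedEmbedding.of_continuous_injective_isClosedMap (by fun_prop)
        (fun s t h => by simpa using h) (isClosedMap_prodMk_left b)

/-- The inverse of the norm is locally integrable on the plane: it is dominated by the product of
the integrable one-dimensional singularities `|x₁|^(-1/2)` and `|x₂|^(-1/2)`. -/
theorem locallyIntegrable_inv_norm : LocallyIntegrable fun x : ℝ × ℝ => ‖x‖⁻¹ := by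
  have h1 : ∀ R : ℝ, IntegrableOn (fun t : ℝ => |t| ^ (-1 / 2 : ℝ)) (Set.Icc (-R) R) := by
    intro R
    rcases lt_or_ge R 0 with hR | hR
    · simp [Set.Icc_eq_empty (show ¬ -R ≤ R by linarith)]
    have hpos : IntervalIntegrable (fun t : ℝ => |t| ^ (-1 / 2 : ℝ)) volume 0 R := by
      refine (intervalIntegral.intervalIntegrable_rpow' (r := -1 / 2) (by norm_num)).congr_uIoo ?_
      intro t ht
      simp only [Set.uIoo_of_le hR, Set.mem_Ioo] at ht
      simp [abs_of_pos ht.1]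
    have hneg : IntervalIntegrable (fun t : ℝ => |t| ^ (-1 / 2 : ℝ)) volume (-R) 0 := by
      have := hpos.comp_sub_left 0
      simp only [zero_sub, abs_neg, sub_zero] at this
      exact this.symm
    have := hneg.trans hpos
    rwa [intervalIntegrable_iff_integrableOn_Icc_of_le (by linarith)] at this
  have h2 : ∀ R : ℝ, IntegrableOn (fun x : ℝ × ℝ => ‖x‖⁻¹) (Set.Icc (-R) R ×ˢ Set.Icc (-R) R) := by
    intro R
    have hp := (h1 R).mul_prod (h1 R)
    rw [Measure.prod_restrict, ← Measure.volume_eq_prod] at hp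
    refine hp.mono' (by fun_prop) ?_
    have hne : ∀ᵐ x : ℝ × ℝ, x.1 ≠ 0 ∧ x.2 ≠ 0 := by
      have h0 : ∀ᵐ t : ℝ, t ≠ 0 := by simp [ae_iff]
      exact (Measure.quasiMeasurePreserving_fst.ae h0).and
        (Measure.quasiMeasurePreserving_snd.ae h0)
    filter_upwards [ae_restrict_of_ae hne] with x hx
    have ha := abs_pos.2 hx.1
    have hb := abs_pos.2 hx.2
    rw [norm_inv, norm_norm, Prod.norm_def, Real.norm_eq_abs, Real.norm_eq_abs]
    set m := max |x.1| |x.2| with hm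
    have hmpos : 0 < m := lt_max_of_lt_left ha
    calc m⁻¹ = m ^ (-1 / 2 : ℝ) * m ^ (-1 / 2 : ℝ) := by
          rw [← Real.rpow_add hmpos]; norm_num [Real.rpow_neg_one]
      _ ≤ |x.1| ^ (-1 / 2 : ℝ) * |x.2| ^ (-1 / 2 : ℝ) := by
          gcongr ?_ * ?_
          · exact Real.rpow_le_rpow_of_nonpos ha (le_max_left _ _) (by norm_num)
          · exact Real.rpow_le_rpow_of_nonpos hb (le_max_right _ _) (by norm_num)
  rw [locallyIntegrable_iff]
  intro K hK
  obtain ⟨R, hR⟩ := hK.isBounded.subset_closedBall 0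
  refine (h2 R).mono_set (hR.trans ?_)
  intro x hx
  rw [mem_closedBall_zero_iff, Prod.norm_def] at hx
  exact ⟨abs_le.1 ((le_max_left _ _).trans hx), abs_le.1 ((le_max_right _ _).trans hx)⟩

theorem locallyIntegrable_of_norm_le {f : ℝ × ℝ → ℂ} {C : ℝ} (hf : ContinuousOn f {0}ᶜ)
    (h : ∀ x ≠ 0, ‖f x‖ ≤ C * (‖x‖⁻¹ + ‖x‖ + 1)) : LocallyIntegrable f := by
  have hne : ∀ᵐ x : ℝ × ℝ, x ≠ 0 := by simp [ae_iff]
  have hm : AEStronglyMeasurable f := by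
    have := hf.aestronglyMeasurable (μ := volume) (measurableSet_singleton (0 : ℝ × ℝ)).compl
    rwa [Measure.restrict_eq_self_of_ae_mem] at this
    filter_upwards [hne] with x hx using hx
  have hb : LocallyIntegrable fun x : ℝ × ℝ => C * (‖x‖⁻¹ + ‖x‖ + 1) := by
    refine LocallyIntegrable.smul (f := fun x : ℝ × ℝ => ‖x‖⁻¹ + ‖x‖ + 1) ?_ C
    exact (locallyIntegrable_inv_norm.add continuous_norm.locallyIntegrable).add
      (locallyIntegrable_const 1)
  refine hb.mono hm ?_
  filter_upwards [hne] with x hx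
  exact (h x hx).trans (le_abs_self _)

/-- A classical derivative away from the origin that is locally integrable is the distributional
derivative. -/
theorem pairing_d {f f' : ℝ × ℝ → ℂ} {i : Fin 2} (hf : LocallyIntegrable f)
    (hf' : LocallyIntegrable f')
    (h : ∀ x ≠ 0, ∃ L : ℝ × ℝ →L[ℝ] ℂ, HasFDerivAt f L x ∧ L (basisVec i) = f' x) (ψ : TestFun) :
    pairing f hf (TestFun.d i ψ) = -pairing f' hf' ψ := by
  have hg : ∀ x ≠ 0, HasFDerivAt (fun x => f x * ψ.1 x)
      (f x • fderiv ℝ ψ.1 x + ψ.1 x • fderiv ℝ f x) x := by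
    intro x hx
    obtain ⟨L, hL, -⟩ := h x hx
    exact hL.differentiableAt.hasFDerivAt.mul (ψ.differentiable x).hasFDerivAt
  have hne : ∀ᵐ x : ℝ × ℝ, x ≠ 0 := by simp [ae_iff]
  have hae : (fun x => f x * (TestFun.d i ψ).1 x + f' x * ψ.1 x) =ᵐ[volume]
      fun x => (f x • fderiv ℝ ψ.1 x + ψ.1 x • fderiv ℝ f x) (basisVec i) := by
    filter_upwards [hne] with x hx
    obtain ⟨L, hL, hi⟩ := h x hx
    simp only [add_apply, smul_apply, hL.fderiv, hi, smul_eq_mul, mul_comm (ψ.1 x)]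
    rfl
  have hi1 := integrable_mul_testFun hf (TestFun.d i ψ)
  have hi2 := integrable_mul_testFun hf' ψ
  have h0 := integral_partial_eq_zero i hg (ψ.hasCompactSupport.mul_left)
    ((hi1.add hi2).congr hae)
  rw [← integral_congr_ae hae, integral_add hi1 hi2] at h0
  exact eq_neg_of_add_eq_zero_left h0

/-- `f` has at most a logarithmic singularity at the origin: the functions `f' i` are its partial
derivatives away from the origin and are `O(1 / ‖x‖)`, while `f` itself obeys a cruder bound, which
is still integrable near the origin. -/
structure IsLogType (f : ℝ × ℝ → ℂ) (f' : Fin 2 → ℝ × ℝ → ℂ) : Prop where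
  hasFDerivAt : ∀ x ≠ 0, ∃ L : ℝ × ℝ →L[ℝ] ℂ, HasFDerivAt f L x ∧ ∀ i, L (basisVec i) = f' i x
  contDiffOn : ContDiffOn ℝ 1 f {0}ᶜ
  bound : ∃ C, ∀ x ≠ 0, ‖f x‖ ≤ C * (‖x‖⁻¹ + ‖x‖ + 1)
  bound_deriv : ∃ C, ∀ i, ∀ x ≠ 0, ‖f' i x‖ ≤ C * ‖x‖⁻¹

namespace IsLogType

variable {f g : ℝ × ℝ → ℂ} {f' g' : Fin 2 → ℝ × ℝ → ℂ}

theorem locallyIntegrable (h : IsLogType f f') : LocallyIntegrable f :=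
  let ⟨_, hC⟩ := h.bound
  locallyIntegrable_of_norm_le h.contDiffOn.continuousOn hC

theorem fderiv_apply (h : IsLogType f f') {x : ℝ × ℝ} (hx : x ≠ 0) (i : Fin 2) :
    fderiv ℝ f x (basisVec i) = f' i x := by
  obtain ⟨L, hL, hi⟩ := h.hasFDerivAt x hx
  rw [hL.fderiv, hi]

theorem locallyIntegrable_deriv (h : IsLogType f f') (i : Fin 2) : LocallyIntegrable (f' i) := by
  obtain ⟨C, hC⟩ := h.bound_deriv
  have hcont : ContinuousOn (f' i) {0}ᶜ := by
    have := (h.contDiffOn.continuousOn_fderiv_of_isOpen isOpen_compl_singleton le_rfl).clm_apply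
      (continuousOn_const (c := basisVec i))
    exact this.congr fun x hx => (h.fderiv_apply hx i).symm
  refine locallyIntegrable_of_norm_le (C := max C 0) hcont fun x hx => (hC i x hx).trans ?_
  have : 0 < ‖x‖ := norm_pos_iff.2 hx
  calc C * ‖x‖⁻¹ ≤ max C 0 * ‖x‖⁻¹ := by gcongr; exact le_max_left _ _
    _ ≤ _ := by gcongr; linarith

theorem pairing_d (h : IsLogType f f') (i : Fin 2) (ψ : TestFun) :
    pairing f h.locallyIntegrable (TestFun.d i ψ)
      = -pairing (f' i) (h.locallyIntegrable_deriv i) ψ :=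
  CubicGreen.pairing_d _ _ (fun x hx => let ⟨L, hL, hi⟩ := h.hasFDerivAt x hx; ⟨L, hL, hi i⟩) ψ

theorem add (h : IsLogType f f') (k : IsLogType g g') :
    IsLogType (fun x => f x + g x) (fun i x => f' i x + g' i x) where
  hasFDerivAt x hx := by
    obtain ⟨L, hL, hi⟩ := h.hasFDerivAt x hx
    obtain ⟨M, hM, hj⟩ := k.hasFDerivAt x hx
    exact ⟨L + M, hL.add hM, fun i => by simp [hi, hj]⟩
  contDiffOn := h.contDiffOn.add k.contDiffOn
  bound := by
    obtain ⟨C, hC⟩ := h.bound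
    obtain ⟨D, hD⟩ := k.bound
    exact ⟨C + D, fun x hx => (norm_add_le _ _).trans
      (by rw [add_mul]; exact add_le_add (hC x hx) (hD x hx))⟩
  bound_deriv := by
    obtain ⟨C, hC⟩ := h.bound_deriv
    obtain ⟨D, hD⟩ := k.bound_deriv
    exact ⟨C + D, fun i x hx => (norm_add_le _ _).trans
      (by rw [add_mul]; exact add_le_add (hC i x hx) (hD i x hx))⟩

theorem const_mul (h : IsLogType f f') (c : ℂ) :
    IsLogType (fun x => c * f x) (fun i x => c * f' i x) where
  hasFDerivAt x hx := by
    obtain ⟨L, hL, hi⟩ := h.hasFDerivAt x hx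
    exact ⟨c • L, hL.const_mul c, fun i => by simp [hi]⟩
  contDiffOn := contDiffOn_const.mul h.contDiffOn
  bound := by
    obtain ⟨C, hC⟩ := h.bound
    exact ⟨‖c‖ * C, fun x hx => by
      rw [norm_mul, mul_assoc]; exact mul_le_mul_of_nonneg_left (hC x hx) (norm_nonneg c)⟩
  bound_deriv := by
    obtain ⟨C, hC⟩ := h.bound_deriv
    exact ⟨‖c‖ * C, fun i x hx => by
      rw [norm_mul, mul_assoc]; exact mul_le_mul_of_nonneg_left (hC i x hx) (norm_nonneg c)⟩

theorem congr (h : IsLogType f f') (hfg : ∀ x ≠ 0, g x = f x) : IsLogType g f' where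
  hasFDerivAt x hx := by
    obtain ⟨L, hL, hi⟩ := h.hasFDerivAt x hx
    exact ⟨L, hL.congr_of_eventuallyEq (by
      filter_upwards [isOpen_compl_singleton.mem_nhds hx] with y hy using hfg y hy), hi⟩
  contDiffOn := h.contDiffOn.congr hfg
  bound := by
    obtain ⟨C, hC⟩ := h.bound
    exact ⟨C, fun x hx => by rw [hfg x hx]; exact hC x hx⟩
  bound_deriv := h.bound_deriv

end IsLogType

/-! ### The logarithm of a complex quadratic form -/

/-- The quadratic form `x₁² + s² x₂²`. -/
def quadForm (s : ℂ) (x : ℝ × ℝ) : ℂ := (x.1 : ℂ) ^ 2 + s ^ 2 * (x.2 : ℂ) ^ 2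

theorem quadForm_mem_slitPlane {s : ℂ} (hs : 0 < s.re) {x : ℝ × ℝ} (hx : x ≠ 0) :
    quadForm s x ∈ Complex.slitPlane := by
  have hre : (quadForm s x).re = x.1 ^ 2 + (s.re ^ 2 - s.im ^ 2) * x.2 ^ 2 := by
    simp [quadForm, pow_two]
  have him : (quadForm s x).im = 2 * s.re * s.im * x.2 ^ 2 := by
    simp only [quadForm, pow_two, Complex.add_im, Complex.mul_im, Complex.mul_re, Complex.ofReal_re,
      Complex.ofReal_im]
    ring
  rw [Complex.mem_slitPlane_iff, hre, him]
  by_cases h2 : x.2 = 0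
  · have h1 : x.1 ≠ 0 := fun h1 => hx (Prod.ext h1 h2)
    left
    rw [h2]
    simpa using pow_pos (abs_pos.2 h1) 2
  · by_cases hb : s.im = 0
    · left
      rw [hb]
      have h2' := sq_nonneg x.1
      have : 0 < s.re ^ 2 * x.2 ^ 2 := by positivity
      linarith
    · right
      positivity

theorem quadForm_ne_zero {s : ℂ} (hs : 0 < s.re) {x : ℝ × ℝ} (hx : x ≠ 0) : quadForm s x ≠ 0 :=
  Complex.slitPlane_ne_zero (quadForm_mem_slitPlane hs hx)

theorem quadForm_smul (s : ℂ) (t : ℝ) (x : ℝ × ℝ) :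
    quadForm s (t • x) = (t : ℂ) ^ 2 * quadForm s x := by
  simp [quadForm]; ring

/-- The coordinates, as continuous real-linear maps to the complex numbers. -/
noncomputable def coord (i : Fin 2) : ℝ × ℝ →L[ℝ] ℂ :=
  Complex.ofRealCLM.comp
    (if i = 0 then ContinuousLinearMap.fst ℝ ℝ ℝ else ContinuousLinearMap.snd ℝ ℝ ℝ)

theorem coord_zero_apply (x : ℝ × ℝ) : coord 0 x = (x.1 : ℂ) := rfl

theorem coord_one_apply (x : ℝ × ℝ) : coord 1 x = (x.2 : ℂ) := rfl

theorem contDiff_quadForm (s : ℂ) {n : WithTop ℕ∞} : ContDiff ℝ n (quadForm s) := by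
  have h : quadForm s = fun x => coord 0 x ^ 2 + s ^ 2 * coord 1 x ^ 2 := rfl
  rw [h]
  fun_prop

theorem hasFDerivAt_quadForm (s : ℂ) (x : ℝ × ℝ) :
    HasFDerivAt (quadForm s)
      ((2 * (x.1 : ℂ)) • coord 0 + (s ^ 2 * (2 * (x.2 : ℂ))) • coord 1) x := by
  have h0 := ((coord 0).hasFDerivAt (x := x)).pow 2
  have h1 := (((coord 1).hasFDerivAt (x := x)).pow 2).const_mul (s ^ 2)
  refine HasFDerivAt.congr_fderiv (show HasFDerivAt (quadForm s) _ x from h0.add h1) ?_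
  ext <;> simp [coord_zero_apply, coord_one_apply]

/-- A continuous function that is positively homogeneous of degree zero is bounded. -/
theorem exists_bound_of_homogeneous {h : ℝ × ℝ → ℂ} (hc : ContinuousOn h {0}ᶜ)
    (hh : ∀ t : ℝ, 0 < t → ∀ x ≠ 0, h (t • x) = h x) : ∃ C, 0 ≤ C ∧ ∀ x ≠ 0, ‖h x‖ ≤ C := by
  obtain ⟨C, hC⟩ := (isCompact_sphere (0 : ℝ × ℝ) 1).exists_bound_of_continuousOn
    (hc.mono fun x hx => by
      have := mem_sphere_zero_iff_norm.1 hx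
      exact fun h0 => by simp [Set.mem_singleton_iff.1 h0] at this)
  refine ⟨max C 0, le_max_right _ _, fun x hx => le_max_of_le_left ?_⟩
  have hpos : 0 < ‖x‖ := norm_pos_iff.2 hx
  rw [← hh ‖x‖⁻¹ (inv_pos.2 hpos) x hx]
  exact hC _ (by simp [norm_smul, hpos.ne'])

theorem exists_bound_of_homogeneous_neg_one {h : ℝ × ℝ → ℂ} (hc : ContinuousOn h {0}ᶜ)
    (hh : ∀ t : ℝ, 0 < t → ∀ x ≠ 0, h (t • x) = (t : ℂ)⁻¹ * h x) :
    ∃ C, 0 ≤ C ∧ ∀ x ≠ 0, ‖h x‖ ≤ C * ‖x‖⁻¹ := by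
  obtain ⟨C, hC0, hC⟩ := exists_bound_of_homogeneous (h := fun x => (‖x‖ : ℂ) * h x)
    ((Complex.continuous_ofReal.comp continuous_norm).continuousOn.mul hc) (by
      intro t ht x hx
      have : (t : ℂ) ≠ 0 := by exact_mod_cast ht.ne'
      simp only [hh t ht x hx, norm_smul, Real.norm_eq_abs, abs_of_pos ht]
      push_cast
      field_simp)
  refine ⟨C, hC0, fun x hx => ?_⟩
  have hpos : 0 < ‖x‖ := norm_pos_iff.2 hx
  have := hC x hx
  rw [norm_mul, Complex.norm_real, norm_norm] at this
  rw [← div_eq_mul_inv, le_div_iff₀ hpos, mul_comm]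
  exact this

/-- The first derivatives of `log (x₁² + s² x₂²)`. -/
noncomputable def logQuadDeriv (s : ℂ) (i : Fin 2) (x : ℝ × ℝ) : ℂ :=
  (if i = 0 then 2 * (x.1 : ℂ) else s ^ 2 * (2 * (x.2 : ℂ))) / quadForm s x

theorem contDiffOn_log_comp {g : ℝ × ℝ → ℂ} (hg : ContDiffOn ℝ 1 g {0}ᶜ)
    (h : ∀ x ≠ 0, g x ∈ Complex.slitPlane) : ContDiffOn ℝ 1 (fun x => Complex.log (g x)) {0}ᶜ :=
  fun x hx => ((Complex.contDiffAt_log (h x hx)).restrict_scalars ℝ).comp_contDiffWithinAt x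
    (hg x hx)

theorem norm_ofReal_log_norm_le {x : ℝ × ℝ} (hx : x ≠ 0) :
    ‖(Real.log ‖x‖ : ℂ)‖ ≤ ‖x‖⁻¹ + ‖x‖ := by
  have hpos : 0 < ‖x‖ := norm_pos_iff.2 hx
  have hinv : 0 < ‖x‖⁻¹ := inv_pos.2 hpos
  have h1 := Real.log_le_sub_one_of_pos hpos
  have h2 := Real.log_le_sub_one_of_pos hinv
  rw [Real.log_inv] at h2
  rw [Complex.norm_real, Real.norm_eq_abs, abs_le]
  constructor <;> linarith

theorem isLogType_log_quadForm {s : ℂ} (hs : 0 < s.re) :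
    IsLogType (fun x => Complex.log (quadForm s x)) (logQuadDeriv s) where
  hasFDerivAt x hx := by
    refine ⟨_, (Complex.hasStrictFDerivAt_log_real
      (quadForm_mem_slitPlane hs hx)).hasFDerivAt.comp x (hasFDerivAt_quadForm s x), fun i => ?_⟩
    fin_cases i <;>
      simp [basisVec, logQuadDeriv, coord_zero_apply, coord_one_apply, div_eq_inv_mul]
  contDiffOn := contDiffOn_log_comp (contDiff_quadForm s).contDiffOn
    fun x hx => quadForm_mem_slitPlane hs hx
  bound := by
    have hlog : ContinuousOn (fun x : ℝ × ℝ => (Real.log ‖x‖ : ℂ)) {0}ᶜ :=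
      Complex.continuous_ofReal.comp_continuousOn
        (continuous_norm.continuousOn.log fun x hx => norm_ne_zero_iff.2 hx)
    -- subtracting `2 log ‖x‖` makes the logarithm homogeneous of degree zero
    obtain ⟨C, hC0, hC⟩ := exists_bound_of_homogeneous
      (h := fun x => Complex.log (quadForm s x) - 2 * (Real.log ‖x‖ : ℂ))
      ((contDiffOn_log_comp (contDiff_quadForm s).contDiffOn
        fun x hx => quadForm_mem_slitPlane hs hx).continuousOn.sub
          (continuousOn_const.mul hlog)) (by
        intro t ht x hx
        have h1 : quadForm s (t • x) = ((t ^ 2 : ℝ) : ℂ) * quadForm s x := by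
          rw [quadForm_smul]; push_cast; rfl
        simp only [h1, norm_smul, Real.norm_eq_abs, abs_of_pos ht]
        rw [Complex.log_ofReal_mul (by positivity) (quadForm_ne_zero hs hx),
          Real.log_mul ht.ne' (norm_ne_zero_iff.2 hx), Real.log_pow]
        push_cast
        ring)
    refine ⟨C + 2, fun x hx => ?_⟩
    have hpos : 0 < ‖x‖ := norm_pos_iff.2 hx
    have hinv : 0 < ‖x‖⁻¹ := inv_pos.2 hpos
    calc ‖Complex.log (quadForm s x)‖
        = ‖(Complex.log (quadForm s x) - 2 * (Real.log ‖x‖ : ℂ)) + 2 * (Real.log ‖x‖ : ℂ)‖ := by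
          rw [sub_add_cancel]
      _ ≤ C + 2 * (‖x‖⁻¹ + ‖x‖) := by
          refine (norm_add_le _ _).trans (add_le_add (hC x hx) ?_)
          rw [norm_mul, Complex.norm_ofNat]
          gcongr
          exact norm_ofReal_log_norm_le hx
      _ ≤ (C + 2) * (‖x‖⁻¹ + ‖x‖ + 1) := by nlinarith [mul_nonneg hC0 (add_pos hinv hpos).le]
  bound_deriv := by
    have h : ∀ i, ∃ C, 0 ≤ C ∧ ∀ x ≠ 0, ‖logQuadDeriv s i x‖ ≤ C * ‖x‖⁻¹ := by
      intro i
      refine exists_bound_of_homogeneous_neg_one ?_ ?_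
      · refine ContinuousOn.div (Continuous.continuousOn ?_)
          (contDiff_quadForm s (n := 0)).continuous.continuousOn
          fun x hx => quadForm_ne_zero hs hx
        split_ifs <;> fun_prop
      · intro t ht x hx
        have h1 : (t : ℂ) ≠ 0 := by exact_mod_cast ht.ne'
        have h2 := quadForm_ne_zero hs hx
        simp only [logQuadDeriv, quadForm_smul]
        split_ifs <;> (simp; field_simp)
    obtain ⟨C, hC0, hC⟩ := h 0
    obtain ⟨D, hD0, hD⟩ := h 1
    refine ⟨C + D, fun i x hx => ?_⟩
    have hinv : 0 ≤ ‖x‖⁻¹ := by positivity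
    fin_cases i
    · exact (hC x hx).trans (by gcongr; linarith)
    · exact (hD x hx).trans (by gcongr; linarith)

/-! ### The angular integral -/

theorem quadForm_cos_sin_mem_slitPlane {s : ℂ} (hs : 0 < s.re) (t : ℝ) :
    quadForm s (Real.cos t, Real.sin t) ∈ Complex.slitPlane := by
  refine quadForm_mem_slitPlane hs fun h => ?_
  have h1 := congrArg Prod.fst h
  have h2 := congrArg Prod.snd h
  simp only [Prod.fst_zero, Prod.snd_zero] at h1 h2
  simpa [h1, h2] using Real.cos_sq_add_sin_sq t

theorem continuous_inv_quadForm_cos_sin {s : ℂ} (hs : 0 < s.re) :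
    Continuous fun t : ℝ => (quadForm s (Real.cos t, Real.sin t))⁻¹ :=
  ((contDiff_quadForm s (n := 0)).continuous.comp (by fun_prop)).inv₀
    fun t => Complex.slitPlane_ne_zero (quadForm_cos_sin_mem_slitPlane hs t)

/-- `log (cos t + i s sin t) - log (cos² t + s² sin² t) / 2` is a primitive of
`i s / (cos² t + s² sin² t)` on `(-π, π)`, and only its first term jumps, by `2 π i`. -/
theorem integral_inv_quadForm_cos_sin {s : ℂ} (hs : 0 < s.re) :
    ∫ t in (-Real.pi)..Real.pi, (quadForm s (Real.cos t, Real.sin t))⁻¹ = 2 * Real.pi / s := by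
  have hs0 : s ≠ 0 := fun h => by simp [h] at hs
  set z : ℝ → ℂ := fun t => (Real.cos t : ℂ) + Complex.I * s * (Real.sin t : ℂ) with hz
  have hzre : ∀ t, (z t).re = Real.cos t - s.im * Real.sin t := fun t => by
    simp only [hz]; simp [-Complex.ofReal_cos, -Complex.ofReal_sin]; ring
  have hzim : ∀ t, (z t).im = s.re * Real.sin t := fun t => by
    simp only [hz]; simp [-Complex.ofReal_cos, -Complex.ofReal_sin]
  have hzc : Continuous z := by fun_prop
  have hmem : ∀ t ∈ Set.Ioo (-Real.pi) Real.pi, z t ∈ Complex.slitPlane := by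
    intro t ht
    rw [Complex.mem_slitPlane_iff, hzre, hzim]
    by_cases h : Real.sin t = 0
    · left
      have : t = 0 := (Real.sin_eq_zero_iff_of_lt_of_lt ht.1 ht.2).1 h
      simp [this]
    · right
      exact mul_ne_zero hs.ne' h
  have hqd : ∀ t : ℝ, HasDerivAt (fun t : ℝ => quadForm s (Real.cos t, Real.sin t))
      (2 * (s ^ 2 - 1) * Real.sin t * Real.cos t) t := by
    intro t
    have hc := (Real.hasDerivAt_cos t).ofReal_comp
    have hsn := (Real.hasDerivAt_sin t).ofReal_comp
    refine HasDerivAt.congr_deriv (f := fun t : ℝ => quadForm s (Real.cos t, Real.sin t))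
      ((hc.pow 2).add ((hsn.pow 2).const_mul (s ^ 2))) ?_
    push_cast
    ring
  have hzd : ∀ t : ℝ, HasDerivAt z (-(Real.sin t : ℂ) + Complex.I * s * Real.cos t) t := by
    intro t
    refine HasDerivAt.congr_deriv (f := z) ((Real.hasDerivAt_cos t).ofReal_comp.add
      ((Real.hasDerivAt_sin t).ofReal_comp.const_mul (Complex.I * s))) ?_
    push_cast
    ring
  have hq : ∀ t : ℝ, quadForm s (Real.cos t, Real.sin t)
      = (Real.cos t : ℂ) ^ 2 + s ^ 2 * (Real.sin t : ℂ) ^ 2 :=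
    fun t => rfl
  have hcs : ∀ t : ℝ, (Real.cos t : ℂ) ^ 2 + (Real.sin t : ℂ) ^ 2 = 1 := fun t => by
    exact_mod_cast Real.cos_sq_add_sin_sq t
  have hF : ∀ t ∈ Set.Ioo (-Real.pi) Real.pi, HasDerivAt
      (fun t => Complex.log (z t) - Complex.log (quadForm s (Real.cos t, Real.sin t)) / 2)
      (Complex.I * s * (quadForm s (Real.cos t, Real.sin t))⁻¹) t := by
    intro t ht
    have h1 := (hzd t).clog_real (hmem t ht)
    have h2 := ((hqd t).clog_real (quadForm_cos_sin_mem_slitPlane hs t)).div_const 2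
    refine HasDerivAt.congr_deriv (h1.sub h2) ?_
    have hz0 := Complex.slitPlane_ne_zero (hmem t ht)
    have hq0 := Complex.slitPlane_ne_zero (quadForm_cos_sin_mem_slitPlane hs t)
    field_simp
    rw [hq]
    simp only [hz]
    linear_combination (Complex.I * s * Real.cos t - s ^ 2 * Real.sin t) * hcs t
      - Real.sin t * s ^ 2 * Complex.I_sq
  have hends : ∀ l : Filter ℝ, ∀ t₀ : ℝ, l ≤ 𝓝 t₀ → Real.cos t₀ = -1 → Real.sin t₀ = 0 → ∀ w,
      Tendsto (fun t => Complex.log (z t)) l (𝓝 w) →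
      Tendsto (fun t => Complex.log (z t) - Complex.log (quadForm s (Real.cos t, Real.sin t)) / 2)
        l (𝓝 w) := by
    intro l t₀ hl hc0 hs0 w hw
    have hq1 : quadForm s (Real.cos t₀, Real.sin t₀) = 1 := by rw [hq, hc0, hs0]; simp
    have : Tendsto (fun t => Complex.log (quadForm s (Real.cos t, Real.sin t)) / 2) l (𝓝 0) := by
      have h := ((hqd t₀).clog_real (quadForm_cos_sin_mem_slitPlane hs t₀)).continuousAt.tendsto
      rw [hq1, Complex.log_one] at h
      simpa using (h.mono_left hl).div_const 2
    simpa using hw.sub this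
  have hm1 : ∀ t₀ : ℝ, Real.cos t₀ = -1 → Real.sin t₀ = 0 → z t₀ = -1 := by
    intro t₀ h1 h2
    simp only [hz, h1, h2]
    simp
  have hpi := hends (𝓝[<] Real.pi) Real.pi nhdsWithin_le_nhds Real.cos_pi Real.sin_pi
    (Real.pi * Complex.I) (by
      have h := Complex.tendsto_log_nhdsWithin_im_nonneg_of_re_neg_of_im_zero (z := -1)
        (by simp) (by simp)
      simp only [norm_neg, norm_one, Real.log_one, Complex.ofReal_zero, zero_add] at h
      refine h.comp (tendsto_nhdsWithin_iff.2 ⟨?_, ?_⟩)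
      · rw [← hm1 Real.pi Real.cos_pi Real.sin_pi]
        exact hzc.continuousAt.tendsto.mono_left nhdsWithin_le_nhds
      · filter_upwards [Ioo_mem_nhdsLT Real.pi_pos] with t ht
        rw [hzim]
        exact (mul_pos hs (Real.sin_pos_of_pos_of_lt_pi ht.1 ht.2)).le)
  have hneg := hends (𝓝[>] (-Real.pi)) (-Real.pi) nhdsWithin_le_nhds (by simp) (by simp)
    (-(Real.pi * Complex.I)) (by
      have h := Complex.tendsto_log_nhdsWithin_im_neg_of_re_neg_of_im_zero (z := -1)
        (by simp) (by simp)
      simp only [norm_neg, norm_one, Real.log_one, Complex.ofReal_zero, zero_sub] at h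
      refine h.comp (tendsto_nhdsWithin_iff.2 ⟨?_, ?_⟩)
      · rw [← hm1 (-Real.pi) (by simp) (by simp)]
        exact hzc.continuousAt.tendsto.mono_left nhdsWithin_le_nhds
      · filter_upwards [Ioo_mem_nhdsGT (neg_lt_zero.2 Real.pi_pos)] with t ht
        rw [hzim]
        exact mul_neg_of_pos_of_neg hs (Real.sin_neg_of_neg_of_neg_pi_lt ht.2 ht.1))
  have hint := intervalIntegral.integral_eq_sub_of_hasDerivAt_of_tendsto
    (by linarith [Real.pi_pos]) hF
    ((continuous_const.mul (continuous_inv_quadForm_cos_sin hs)).intervalIntegrable _ _) hneg hpi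
  rw [intervalIntegral.integral_const_mul] at hint
  have hI := Complex.I_ne_zero
  rw [eq_div_iff hs0]
  refine mul_left_cancel₀ hI ?_
  linear_combination hint

/-! ### The distributional equation for the logarithm -/

theorem hasDerivAt_radial (ψ : TestFun) (a b t : ℝ) :
    HasDerivAt (fun t : ℝ => ψ.1 (t * a, t * b))
      (a * (TestFun.d 0 ψ).1 (t * a, t * b) + b * (TestFun.d 1 ψ).1 (t * a, t * b)) t := by
  have hL : HasDerivAt (fun t : ℝ => (t * a, t * b)) (a, b) t := by
    simpa using ((hasDerivAt_id t).mul_const a).prodMk ((hasDerivAt_id t).mul_const b)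
  refine ((ψ.differentiable _).hasFDerivAt.comp_hasDerivAt t hL).congr_deriv ?_
  have : ((a, b) : ℝ × ℝ) = a • basisVec 0 + b • basisVec 1 := by simp [basisVec]
  rw [this, map_add, map_smul, map_smul]
  simp [TestFun.d_apply]

theorem exists_radius (ψ : TestFun) : ∃ R : ℝ, 0 < R ∧ ∀ x : ℝ × ℝ, R < ‖x‖ → ψ.1 x = 0 := by
  obtain ⟨R, hR⟩ := ψ.hasCompactSupport.isCompact.isBounded.subset_closedBall 0
  refine ⟨max R 1, by positivity, fun x hx => ?_⟩
  by_contra h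
  have := hR (subset_tsupport _ h)
  rw [mem_closedBall_zero_iff] at this
  exact absurd hx (not_lt.2 (this.trans (le_max_left _ _)))

/-- The factor `2` makes up for the norm of the plane being the maximum norm. -/
theorem le_norm_polar (t θ : ℝ) :
    t ≤ 2 * ‖((t * Real.cos θ, t * Real.sin θ) : ℝ × ℝ)‖ := by
  have h1 : |t * Real.cos θ| ≤ ‖((t * Real.cos θ, t * Real.sin θ) : ℝ × ℝ)‖ := le_max_left _ _
  have h2 : |t * Real.sin θ| ≤ ‖((t * Real.cos θ, t * Real.sin θ) : ℝ × ℝ)‖ := le_max_right _ _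
  set N := ‖((t * Real.cos θ, t * Real.sin θ) : ℝ × ℝ)‖
  have hN : 0 ≤ N := norm_nonneg _
  have h3 := sq_le_sq' (by linarith [abs_nonneg (t * Real.cos θ)]) h1
  have h4 := sq_le_sq' (by linarith [abs_nonneg (t * Real.sin θ)]) h2
  rw [sq_abs] at h3 h4
  refine abs_le_of_sq_le_sq' ?_ (by linarith) |>.2
  nlinarith [Real.cos_sq_add_sin_sq θ, sq_nonneg t]

/-- In polar coordinates the radial derivative of `ψ` integrates to `-ψ 0` along every ray. -/
theorem integral_radial_deriv_div_quadForm {s : ℂ} (hs : 0 < s.re) (ψ : TestFun) :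
    ∫ x : ℝ × ℝ, (x.1 * (TestFun.d 0 ψ).1 x + x.2 * (TestFun.d 1 ψ).1 x) / quadForm s x
      = -(2 * Real.pi / s) * ψ.1 0 := by
  -- the integrand in polar coordinates, including the Jacobian: all powers of the radius cancel
  set G : ℝ × ℝ → ℂ := fun p => (quadForm s (Real.cos p.2, Real.sin p.2))⁻¹ *
    (Real.cos p.2 * (TestFun.d 0 ψ).1 (p.1 * Real.cos p.2, p.1 * Real.sin p.2)
      + Real.sin p.2 * (TestFun.d 1 ψ).1 (p.1 * Real.cos p.2, p.1 * Real.sin p.2)) with hG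
  have hGc : Continuous G := by
    refine ((continuous_inv_quadForm_cos_sin hs).comp continuous_snd).mul ?_
    have hp : Continuous fun p : ℝ × ℝ => (p.1 * Real.cos p.2, p.1 * Real.sin p.2) := by fun_prop
    have h0 := (TestFun.d 0 ψ).continuous.comp hp
    have h1 := (TestFun.d 1 ψ).continuous.comp hp
    exact ((Complex.continuous_ofReal.comp (by fun_prop)).mul h0).add
      ((Complex.continuous_ofReal.comp (by fun_prop)).mul h1)
  obtain ⟨R0, hR0, hψ0⟩ := exists_radius (TestFun.d 0 ψ)
  obtain ⟨R1, hR1, hψ1⟩ := exists_radius (TestFun.d 1 ψ)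
  obtain ⟨R2, hR2, hψ2⟩ := exists_radius ψ
  have hlarge : ∀ R t θ : ℝ, 0 < R → 2 * R < t →
      R < ‖((t * Real.cos θ, t * Real.sin θ) : ℝ × ℝ)‖ := by
    intro R t θ hR ht
    have := le_norm_polar t θ
    linarith
  have hGi : Integrable G ((volume.restrict (Set.Ioi 0)).prod
      (volume.restrict (Set.Ioo (-Real.pi) Real.pi))) := by
    rw [Measure.prod_restrict, ← Measure.volume_eq_prod]
    change IntegrableOn G _ _
    have hK : IntegrableOn G (Set.Icc 0 (2 * (R0 + R1)) ×ˢ Set.Icc (-Real.pi) Real.pi) :=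
      hGc.continuousOn.integrableOn_compact (isCompact_Icc.prod isCompact_Icc)
    refine hK.of_forall_sdiff_eq_zero (measurableSet_Ioi.prod measurableSet_Ioo) ?_
    rintro ⟨t, θ⟩ ⟨⟨ht, hθ⟩, hnot⟩
    have ht' : 2 * (R0 + R1) < t := by
      by_contra h
      exact hnot ⟨⟨(le_of_lt ht), not_lt.1 h⟩, ⟨hθ.1.le, hθ.2.le⟩⟩
    simp only [hG]
    rw [hψ0 _ (hlarge R0 t θ hR0 (by linarith)), hψ1 _ (hlarge R1 t θ hR1 (by linarith))]
    simp
  have hinner : ∀ θ : ℝ, ∫ t in Set.Ioi (0 : ℝ), G (t, θ)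
      = -(quadForm s (Real.cos θ, Real.sin θ))⁻¹ * ψ.1 0 := by
    intro θ
    simp only [hG]
    rw [integral_const_mul, integral_Ioi_of_hasDerivAt_of_tendsto (m := 0)
      (f := fun t : ℝ => ψ.1 (t * Real.cos θ, t * Real.sin θ))
      (ψ.continuous.comp (by fun_prop)).continuousWithinAt
      (fun t _ => hasDerivAt_radial ψ _ _ t)]
    · simp only [zero_mul, zero_sub]
      rw [show ((0 : ℝ), (0 : ℝ)) = 0 from rfl]
      ring
    · have hc : Continuous fun t : ℝ =>
          (Real.cos θ * (TestFun.d 0 ψ).1 (t * Real.cos θ, t * Real.sin θ)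
            + Real.sin θ * (TestFun.d 1 ψ).1 (t * Real.cos θ, t * Real.sin θ) : ℂ) := by
        have hp : Continuous fun t : ℝ => (t * Real.cos θ, t * Real.sin θ) := by fun_prop
        exact (continuous_const.mul ((TestFun.d 0 ψ).continuous.comp hp)).add
          (continuous_const.mul ((TestFun.d 1 ψ).continuous.comp hp))
      refine (hc.integrableOn_Icc (a := 0) (b := 2 * (R0 + R1))).of_forall_sdiff_eq_zero
        measurableSet_Ioi ?_
      rintro t ⟨ht, hnot⟩
      have ht' : 2 * (R0 + R1) < t := by
        by_contra h
        exact hnot ⟨le_of_lt ht, not_lt.1 h⟩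
      rw [hψ0 _ (hlarge R0 t θ hR0 (by linarith)), hψ1 _ (hlarge R1 t θ hR1 (by linarith))]
      simp
    · refine tendsto_const_nhds.congr' ?_
      filter_upwards [eventually_gt_atTop (2 * R2)] with t ht
      exact (hψ2 _ (hlarge R2 t θ hR2 ht)).symm
  rw [← integral_comp_polarCoord_symm]
  have hcongr : ∀ p ∈ polarCoord.target, p.1 • ((((polarCoord.symm p).1 : ℂ) *
      (TestFun.d 0 ψ).1 (polarCoord.symm p) + ((polarCoord.symm p).2 : ℂ) *
      (TestFun.d 1 ψ).1 (polarCoord.symm p)) / quadForm s (polarCoord.symm p)) = G p := by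
    rintro ⟨t, θ⟩ hp
    have ht : 0 < t := hp.1
    have ht' : (t : ℂ) ≠ 0 := by exact_mod_cast ht.ne'
    have hq : quadForm s (t * Real.cos θ, t * Real.sin θ)
        = (t : ℂ) ^ 2 * quadForm s (Real.cos θ, Real.sin θ) := by
      simp [quadForm]; ring
    have hq0 := Complex.slitPlane_ne_zero (quadForm_cos_sin_mem_slitPlane hs θ)
    simp only [hG, polarCoord_symm_apply, hq]
    rw [Complex.real_smul]
    push_cast
    field_simp
  rw [setIntegral_congr_fun polarCoord.open_target.measurableSet hcongr, polarCoord_target,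
    Measure.volume_eq_prod, ← Measure.prod_restrict, integral_prod_symm _ hGi]
  simp only [hinner]
  rw [integral_mul_const, integral_neg, ← integral_Ioc_eq_integral_Ioo,
    ← intervalIntegral.integral_of_le (by linarith [Real.pi_pos]), integral_inv_quadForm_cos_sin hs]

/-- `(∂₂² + s² ∂₁²) log (x₁² + s² x₂²) = 4 π s δ` in the sense of distributions. -/
theorem pairing_log_quadForm {s : ℂ} (hs : 0 < s.re) (ψ : TestFun) :
    pairing _ (isLogType_log_quadForm hs).locallyIntegrable (TestFun.d 1 (TestFun.d 1 ψ))
      + s ^ 2 * pairing _ (isLogType_log_quadForm hs).locallyIntegrable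
          (TestFun.d 0 (TestFun.d 0 ψ)) = 4 * Real.pi * s * ψ.1 0 := by
  have hs0 : s ≠ 0 := fun h => by simp [h] at hs
  have h := isLogType_log_quadForm hs
  rw [h.pairing_d, h.pairing_d, pairing_apply, pairing_apply]
  have hi0 := integrable_mul_testFun (h.locallyIntegrable_deriv 0) (TestFun.d 0 ψ)
  have hi1 := integrable_mul_testFun (h.locallyIntegrable_deriv 1) (TestFun.d 1 ψ)
  have hr := integral_radial_deriv_div_quadForm hs ψ
  have : (∫ x, logQuadDeriv s 1 x * (TestFun.d 1 ψ).1 x)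
      + s ^ 2 * ∫ x, logQuadDeriv s 0 x * (TestFun.d 0 ψ).1 x
      = 2 * s ^ 2 * ∫ x : ℝ × ℝ,
        (x.1 * (TestFun.d 0 ψ).1 x + x.2 * (TestFun.d 1 ψ).1 x) / quadForm s x := by
    rw [← integral_const_mul, ← integral_const_mul, ← integral_add hi1 (hi0.const_mul _)]
    refine integral_congr_ae (Eventually.of_forall fun x => ?_)
    simp [logQuadDeriv]
    ring
  rw [hr] at this
  field_simp at this
  linear_combination -this

/-! ### The difference of two elliptic angles -/

theorem IsLogType.congr_deriv {f : ℝ × ℝ → ℂ} {f' g' : Fin 2 → ℝ × ℝ → ℂ} (h : IsLogType f f')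
    (hfg : ∀ i, ∀ x ≠ 0, g' i x = f' i x) : IsLogType f g' where
  hasFDerivAt x hx := by
    obtain ⟨L, hL, hi⟩ := h.hasFDerivAt x hx
    exact ⟨L, hL, fun i => by rw [hi, hfg i x hx]⟩
  contDiffOn := h.contDiffOn
  bound := h.bound
  bound_deriv := by
    obtain ⟨C, hC⟩ := h.bound_deriv
    exact ⟨C, fun i x hx => by rw [hfg i x hx]; exact hC i x hx⟩

/-- The linear form `x₁ + i s x₂`, a linear factor of `quadForm s`. -/
def linForm (s : ℂ) (x : ℝ × ℝ) : ℂ := (x.1 : ℂ) + s * Complex.I * (x.2 : ℂ)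

theorem linForm_re (s : ℂ) (x : ℝ × ℝ) : (linForm s x).re = x.1 - s.im * x.2 := by
  simp [linForm]; ring

theorem linForm_im (s : ℂ) (x : ℝ × ℝ) : (linForm s x).im = s.re * x.2 := by
  simp [linForm]

theorem linForm_mul_linForm_neg (s : ℂ) (x : ℝ × ℝ) :
    linForm s x * linForm (-s) x = quadForm s x := by
  simp only [linForm, quadForm]
  linear_combination (-s ^ 2 * (x.2 : ℂ) ^ 2) * Complex.I_sq

theorem linForm_ne_zero {s : ℂ} (hs : s.re ≠ 0) {x : ℝ × ℝ} (hx : x ≠ 0) : linForm s x ≠ 0 := by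
  intro h
  have h1 : (linForm s x).re = 0 := by rw [h]; rfl
  have h2 : (linForm s x).im = 0 := by rw [h]; rfl
  rw [linForm_re] at h1
  rw [linForm_im] at h2
  have h3 : x.2 = 0 := by simpa [hs] using h2
  exact hx (Prod.ext (by simpa [h3] using h1) h3)

theorem linForm_smul (s : ℂ) (c : ℝ) (x : ℝ × ℝ) : linForm s (c • x) = (c : ℂ) * linForm s x := by
  simp [linForm]; ring

/-- Were the quotient a nonpositive real `-k`, the form `linForm t + k * linForm s` would vanish at
`x`; but it is `1 + k` times a form of the same kind. -/
theorem linForm_div_mem_slitPlane {s t : ℂ} (hst : 0 < s.re * t.re) {x : ℝ × ℝ} (hx : x ≠ 0) :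
    linForm t x / linForm s x ∈ Complex.slitPlane := by
  have hs : s.re ≠ 0 := fun h => by simp [h] at hst
  have ht : t.re ≠ 0 := fun h => by simp [h] at hst
  have hs0 := linForm_ne_zero hs hx
  rw [Complex.mem_slitPlane_iff]
  by_contra! h
  set k : ℝ := -(linForm t x / linForm s x).re with hk
  have hk0 : 0 ≤ k := by rw [hk]; linarith [h.1]
  have hz : linForm t x / linForm s x = ((-k : ℝ) : ℂ) := by
    apply Complex.ext <;> simp [hk, h.2]
  rw [div_eq_iff hs0] at hz
  have hre := congrArg Complex.re hz
  have him := congrArg Complex.im hz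
  rw [Complex.re_ofReal_mul, linForm_re, linForm_re] at hre
  rw [Complex.im_ofReal_mul, linForm_im, linForm_im] at him
  have h2 : (t.re + k * s.re) * x.2 = 0 := by linarith
  have hne : t.re + k * s.re ≠ 0 := by
    intro h0
    have h1 : s.re * (t.re + k * s.re) = 0 := by rw [h0, mul_zero]
    nlinarith [mul_nonneg hk0 (sq_nonneg s.re)]
  have hx2 : x.2 = 0 := (mul_eq_zero.1 h2).resolve_left hne
  rw [hx2] at hre
  have hx1 : (1 + k) * x.1 = 0 := by linarith
  exact hx (Prod.ext ((mul_eq_zero.1 hx1).resolve_left (by positivity)) hx2)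

theorem contDiff_linForm (s : ℂ) {n : WithTop ℕ∞} : ContDiff ℝ n (linForm s) := by
  have h : linForm s = fun x => coord 0 x + s * Complex.I * coord 1 x := rfl
  rw [h]
  fun_prop

theorem hasFDerivAt_linForm (s : ℂ) (x : ℝ × ℝ) :
    HasFDerivAt (linForm s) (coord 0 + (s * Complex.I) • coord 1) x :=
  (coord 0).hasFDerivAt.add ((coord 1).hasFDerivAt.const_mul (s * Complex.I))

/-- The logarithmic derivatives of `linForm s`. -/
noncomputable def logLinDeriv (s : ℂ) (i : Fin 2) (x : ℝ × ℝ) : ℂ :=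
  (if i = 0 then 1 else s * Complex.I) / linForm s x

theorem exists_bound_logLinDeriv {s : ℂ} (hs : s.re ≠ 0) (i : Fin 2) :
    ∃ C, 0 ≤ C ∧ ∀ x ≠ 0, ‖logLinDeriv s i x‖ ≤ C * ‖x‖⁻¹ := by
  refine exists_bound_of_homogeneous_neg_one ?_ ?_
  · exact continuousOn_const.div (contDiff_linForm s (n := 0)).continuous.continuousOn
      fun x hx => linForm_ne_zero hs hx
  · intro c hc x hx
    have h1 : (c : ℂ) ≠ 0 := by exact_mod_cast hc.ne'
    have h2 := linForm_ne_zero hs hx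
    simp only [logLinDeriv, linForm_smul]
    field_simp

theorem contDiffOn_log_linForm_div {s t : ℂ} (hst : 0 < s.re * t.re) :
    ContDiffOn ℝ 1 (fun x => Complex.log (linForm t x / linForm s x)) {0}ᶜ := by
  have hs : s.re ≠ 0 := fun h => by simp [h] at hst
  refine contDiffOn_log_comp ?_ fun x hx => linForm_div_mem_slitPlane hst hx
  simp only [div_eq_mul_inv]
  exact (contDiff_linForm t).contDiffOn.mul ((contDiff_linForm s).contDiffOn.inv
    fun x hx => linForm_ne_zero hs hx)

theorem isLogType_log_linForm_div {s t : ℂ} (hst : 0 < s.re * t.re) :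
    IsLogType (fun x => Complex.log (linForm t x / linForm s x))
      (fun i x => logLinDeriv t i x - logLinDeriv s i x) where
  hasFDerivAt x hx := by
    have hs : s.re ≠ 0 := fun h => by simp [h] at hst
    have ht : t.re ≠ 0 := fun h => by simp [h] at hst
    have hs0 := linForm_ne_zero hs hx
    have ht0 := linForm_ne_zero ht hx
    have hinv := (hasDerivAt_inv hs0).complexToReal_fderiv.comp x (hasFDerivAt_linForm s x)
    have hdiv := (hasFDerivAt_linForm t x).mul hinv
    have hlog := (Complex.hasDerivAt_log (linForm_div_mem_slitPlane hst hx)).complexToReal_fderiv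
    refine ⟨_, HasFDerivAt.comp (f := fun x => linForm t x / linForm s x) x hlog hdiv, fun i => ?_⟩
    fin_cases i <;>
    · simp [basisVec, logLinDeriv, coord_zero_apply, coord_one_apply]
      field_simp
      ring
  contDiffOn := contDiffOn_log_linForm_div hst
  bound := by
    have hs : s.re ≠ 0 := fun h => by simp [h] at hst
    obtain ⟨C, hC0, hC⟩ := exists_bound_of_homogeneous (contDiffOn_log_linForm_div hst).continuousOn
      (by
        intro c hc x hx
        have h1 : (c : ℂ) ≠ 0 := by exact_mod_cast hc.ne'
        simp only [linForm_smul]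
        rw [mul_div_mul_left _ _ h1])
    refine ⟨C, fun x hx => (hC x hx).trans ?_⟩
    have hpos : 0 < ‖x‖ := norm_pos_iff.2 hx
    have hinv : 0 < ‖x‖⁻¹ := inv_pos.2 hpos
    nlinarith [mul_nonneg hC0 (add_pos hinv hpos).le]
  bound_deriv := by
    have hs : s.re ≠ 0 := fun h => by simp [h] at hst
    have ht : t.re ≠ 0 := fun h => by simp [h] at hst
    have h : ∀ i, ∃ C, 0 ≤ C ∧ ∀ x ≠ 0, ‖logLinDeriv t i x - logLinDeriv s i x‖ ≤ C * ‖x‖⁻¹ := by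
      intro i
      obtain ⟨C, hC0, hC⟩ := exists_bound_logLinDeriv ht i
      obtain ⟨D, hD0, hD⟩ := exists_bound_logLinDeriv hs i
      exact ⟨C + D, by positivity, fun x hx => (norm_sub_le _ _).trans
        (by rw [add_mul]; exact add_le_add (hC x hx) (hD x hx))⟩
    obtain ⟨C, hC0, hC⟩ := h 0
    obtain ⟨D, hD0, hD⟩ := h 1
    refine ⟨C + D, fun i x hx => ?_⟩
    have hinv : 0 ≤ ‖x‖⁻¹ := by positivity
    fin_cases i
    · exact (hC x hx).trans (by gcongr; linarith)
    · exact (hD x hx).trans (by gcongr; linarith)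

/-- The difference `arctan (t x₂ / x₁) - arctan (s x₂ / x₁)`, extended smoothly across the line
`x₁ = 0`. -/
noncomputable def angleDiff (s t : ℂ) (x : ℝ × ℝ) : ℂ :=
  -Complex.I / 2 * (Complex.log (linForm t x / linForm s x)
    - Complex.log (linForm (-t) x / linForm (-s) x))

/-- The first derivatives of `angleDiff s t`. -/
noncomputable def angleDiffDeriv (s t : ℂ) : Fin 2 → ℝ × ℝ → ℂ :=
  ![fun x => 1 / (2 * s) * logQuadDeriv s 1 x - 1 / (2 * t) * logQuadDeriv t 1 x,
    fun x => t / 2 * logQuadDeriv t 0 x - s / 2 * logQuadDeriv s 0 x]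

/-- The derivatives of the angles are, up to constant factors, those of the logarithms in the other
variable. -/
theorem isLogType_angleDiff {s t : ℂ} (hs : 0 < s.re) (ht : 0 < t.re) :
    IsLogType (angleDiff s t) (angleDiffDeriv s t) := by
  have h1 := isLogType_log_linForm_div (mul_pos hs ht)
  have h2 := isLogType_log_linForm_div (s := -s) (t := -t) (by simpa using mul_pos hs ht)
  have h := (h1.add (h2.const_mul (-1))).const_mul (-Complex.I / 2)
  refine (h.congr fun x _ => ?_).congr_deriv fun i x hx => ?_
  · simp only [angleDiff]; ring
  have hs0 : s ≠ 0 := fun h => by simp [h] at hs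
  have ht0 : t ≠ 0 := fun h => by simp [h] at ht
  have key : ∀ z : ℂ, 0 < z.re → logLinDeriv z i x - logLinDeriv (-z) i x
      = 2 * Complex.I * (if i = 0 then -(1 / (2 * z)) * logQuadDeriv z 1 x
          else z / 2 * logQuadDeriv z 0 x) := by
    intro z hz
    have hz0 : z ≠ 0 := fun h => by simp [h] at hz
    have hp := linForm_ne_zero hz.ne' hx
    have hm := linForm_ne_zero (s := -z) (by simpa using hz.ne') hx
    simp only [logLinDeriv, logQuadDeriv]
    rw [← linForm_mul_linForm_neg]
    fin_cases i
    · simp only [Fin.zero_eta, if_true, one_ne_zero, if_false]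
      field_simp
      simp only [linForm]
      ring
    · simp only [Fin.mk_one, if_true, one_ne_zero, if_false]
      field_simp
      simp only [linForm]
      ring
  have ks := key s hs
  have kt := key t ht
  fin_cases i
  · simp only [angleDiffDeriv, Fin.zero_eta, Matrix.cons_val_zero, if_true] at ks kt ⊢
    linear_combination (Complex.I / 2) * (kt - ks)
      + (1 / (2 * s) * logQuadDeriv s 1 x - 1 / (2 * t) * logQuadDeriv t 1 x) * Complex.I_sq
  · simp only [angleDiffDeriv, Fin.mk_one, Matrix.cons_val_one, Matrix.cons_val_zero, one_ne_zero,
      if_false] at ks kt ⊢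
    linear_combination (Complex.I / 2) * (kt - ks)
      + (t / 2 * logQuadDeriv t 0 x - s / 2 * logQuadDeriv s 0 x) * Complex.I_sq

theorem angleDiff_of_fst_eq_zero {s t : ℂ} {x : ℝ × ℝ} (hx : x.1 = 0) : angleDiff s t x = 0 := by
  simp [angleDiff, linForm, hx]

theorem one_add_mul_I_eq_linForm (s : ℂ) (y : ℝ) : 1 + s * y * Complex.I = linForm s (1, y) := by
  simp [linForm]; ring

theorem one_sub_mul_I_eq_linForm (s : ℂ) (y : ℝ) :
    1 - s * y * Complex.I = linForm (-s) (1, y) := by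
  simp [linForm]; ring

/-- `(1 + i z) / (1 - i z)` avoids the cut of the logarithm when `z = s y` with `y` real and
`Re s > 0`. -/
theorem linForm_one_div_mem_slitPlane {s : ℂ} (hs : 0 < s.re) (y : ℝ) :
    linForm s (1, y) / linForm (-s) (1, y) ∈ Complex.slitPlane := by
  have hx : ((1, y) : ℝ × ℝ) ≠ 0 := fun h => one_ne_zero (congrArg Prod.fst h)
  have hm := linForm_ne_zero (s := -s) (by simpa using hs.ne') hx
  rw [Complex.mem_slitPlane_iff]
  by_contra! h
  set k : ℝ := -(linForm s (1, y) / linForm (-s) (1, y)).re with hk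
  have hk0 : 0 ≤ k := by rw [hk]; linarith [h.1]
  have hz : linForm s (1, y) / linForm (-s) (1, y) = ((-k : ℝ) : ℂ) := by
    apply Complex.ext <;> simp [hk, h.2]
  rw [div_eq_iff hm] at hz
  have hre := congrArg Complex.re hz
  have him := congrArg Complex.im hz
  rw [Complex.re_ofReal_mul, linForm_re, linForm_re] at hre
  rw [Complex.im_ofReal_mul, linForm_im, linForm_im] at him
  simp only [Complex.neg_re, Complex.neg_im] at hre him
  have h2 : s.re * ((1 - k) * y) = 0 := by linarith
  rcases mul_eq_zero.1 ((mul_eq_zero.1 h2).resolve_left hs.ne') with h3 | h3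
  · have : k = 1 := by linarith
    rw [this] at hre
    linarith
  · rw [h3] at hre
    linarith

/-- Both sides have the same derivative along the lines through the point `(1, 0)` that are parallel
to the second axis, and both vanish on the first axis. -/
theorem angleDiff_eq_arctan_sub {s t : ℂ} (hs : 0 < s.re) (ht : 0 < t.re) {x : ℝ × ℝ}
    (hx : x.1 ≠ 0) :
    angleDiff s t x = Complex.arctan (t * (x.2 : ℂ) / (x.1 : ℂ))
      - Complex.arctan (s * (x.2 : ℂ) / (x.1 : ℂ)) := by
  have hx1 : (x.1 : ℂ) ≠ 0 := by exact_mod_cast hx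
  have hne : ∀ y : ℝ, ((1, y) : ℝ × ℝ) ≠ 0 := fun y h => one_ne_zero (congrArg Prod.fst h)
  have hlin : ∀ (z : ℂ) (y : ℝ), HasDerivAt (fun y : ℝ => linForm z (1, y)) (z * Complex.I) y := by
    intro z y
    have := ((hasDerivAt_id y).ofReal_comp.const_mul (z * Complex.I)).const_add (1 : ℂ)
    simpa [linForm] using this
  have hquot : ∀ (z w : ℂ) (y : ℝ), linForm w (1, y) ≠ 0 →
      linForm z (1, y) / linForm w (1, y) ∈ Complex.slitPlane →
      HasDerivAt (fun y : ℝ => Complex.log (linForm z (1, y) / linForm w (1, y)))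
        (z * Complex.I / linForm z (1, y) - w * Complex.I / linForm w (1, y)) y := by
    intro z w y hw h
    refine (((hlin z y).div (hlin w y) hw).clog_real h).congr_deriv ?_
    have hz : linForm z (1, y) ≠ 0 := fun h0 => by
      simp [h0] at h
    simp only [Pi.div_apply]
    field_simp
  set F : ℝ → ℂ := fun y =>
    (Complex.log (linForm t (1, y) / linForm s (1, y))
      - Complex.log (linForm (-t) (1, y) / linForm (-s) (1, y)))
    - (Complex.log (linForm t (1, y) / linForm (-t) (1, y))
      - Complex.log (linForm s (1, y) / linForm (-s) (1, y))) with hF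
  have hFd : ∀ y, HasDerivAt F 0 y := by
    intro y
    have h1 := linForm_ne_zero hs.ne' (hne y)
    have h2 := linForm_ne_zero (s := -s) (by simpa using hs.ne') (hne y)
    have h3 := linForm_ne_zero (s := -t) (by simpa using ht.ne') (hne y)
    refine (((hquot t s y h1 (linForm_div_mem_slitPlane (mul_pos hs ht) (hne y))).sub
      (hquot (-t) (-s) y h2 (linForm_div_mem_slitPlane (by simpa using mul_pos hs ht) (hne y)))).sub
      ((hquot t (-t) y h3 (linForm_one_div_mem_slitPlane ht y)).sub
      (hquot s (-s) y h2 (linForm_one_div_mem_slitPlane hs y)))).congr_deriv ?_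
    ring
  have hF0 : ∀ y, F y = 0 := by
    intro y
    rw [is_const_of_deriv_eq_zero (fun y => (hFd y).differentiableAt) (fun y => (hFd y).deriv) y 0]
    simp [hF, linForm]
  have hscale : ∀ z : ℂ, linForm z x = (x.1 : ℂ) * linForm z (1, x.2 / x.1) := by
    intro z
    rw [← linForm_smul]
    congr 1
    ext <;> simp
    field_simp
  have harc : ∀ z : ℂ, Complex.arctan (z * (x.2 : ℂ) / (x.1 : ℂ)) = -Complex.I / 2 *
      Complex.log (linForm z (1, x.2 / x.1) / linForm (-z) (1, x.2 / x.1)) := by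
    intro z
    rw [Complex.arctan, ← one_add_mul_I_eq_linForm, ← one_sub_mul_I_eq_linForm]
    push_cast
    rw [mul_div_assoc]
  rw [harc, harc, angleDiff, hscale, hscale, hscale (-t), hscale (-s), mul_div_mul_left _ _ hx1,
    mul_div_mul_left _ _ hx1]
  have := hF0 (x.2 / x.1)
  simp only [hF] at this
  linear_combination (-Complex.I / 2) * this

/-! ### Complex conjugation -/

theorem conj_log_quadForm {s : ℂ} (hs : 0 < s.re) {x : ℝ × ℝ} (hx : x ≠ 0) :
    (starRingEnd ℂ) (Complex.log (quadForm s x)) = Complex.log (quadForm (starRingEnd ℂ s) x) := by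
  rw [← Complex.log_conj _ (Complex.slitPlane_arg_ne_pi (quadForm_mem_slitPlane hs hx))]
  simp [quadForm]

theorem conj_linForm (s : ℂ) (x : ℝ × ℝ) :
    (starRingEnd ℂ) (linForm s x) = linForm (-(starRingEnd ℂ s)) x := by
  simp [linForm]

theorem conj_angleDiff {s t : ℂ} (hs : 0 < s.re) (ht : 0 < t.re) {x : ℝ × ℝ} (hx : x ≠ 0) :
    (starRingEnd ℂ) (angleDiff s t x) = angleDiff (starRingEnd ℂ s) (starRingEnd ℂ t) x := by
  have h1 := Complex.slitPlane_arg_ne_pi (linForm_div_mem_slitPlane (mul_pos hs ht) hx)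
  have h2 := Complex.slitPlane_arg_ne_pi (linForm_div_mem_slitPlane (s := -s) (t := -t)
    (by simpa using mul_pos hs ht) hx)
  simp only [angleDiff, map_mul, map_sub, map_div₀, map_neg, Complex.conj_I]
  rw [← Complex.log_conj _ h1, ← Complex.log_conj _ h2]
  simp only [map_div₀, conj_linForm, map_neg, neg_neg, map_ofNat]
  ring

theorem angleDiff_comm {s t : ℂ} (hs : 0 < s.re) (ht : 0 < t.re) {x : ℝ × ℝ} (hx : x ≠ 0) :
    angleDiff t s x = -angleDiff s t x := by
  have h1 := Complex.slitPlane_arg_ne_pi (linForm_div_mem_slitPlane (mul_pos hs ht) hx)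
  have h2 := Complex.slitPlane_arg_ne_pi (linForm_div_mem_slitPlane (s := -s) (t := -t)
    (by simpa using mul_pos hs ht) hx)
  simp only [angleDiff]
  rw [← inv_div (linForm t x), ← inv_div (linForm (-t) x), Complex.log_inv _ h1,
    Complex.log_inv _ h2]
  ring

/-! ### The roots of the characteristic polynomial -/

/-- The material is stable and not isotropic. -/
structure Admissible (lam mu mus : ℝ) : Prop where
  mu_pos : 0 < mu
  lam_mu_pos : 0 < lam + mu
  mus_pos : 0 < mus
  mus_ne : mus ≠ mu

theorem csqrt_sq (z : ℂ) : csqrt z ^ 2 = z := by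
  simp [csqrt]

theorem csqrt_eq_exp {z : ℂ} (hz : z ≠ 0) : csqrt z = Complex.exp (Complex.log z / 2) := by
  rw [csqrt, Complex.cpow_def_of_ne_zero hz]
  congr 1
  ring

theorem csqrt_re_pos {z : ℂ} (hz : z ∈ Complex.slitPlane) : 0 < (csqrt z).re := by
  rw [csqrt_eq_exp (Complex.slitPlane_ne_zero hz), Complex.exp_re]
  refine mul_pos (Real.exp_pos _) (Real.cos_pos_of_mem_Ioo ?_)
  have h1 := Complex.neg_pi_lt_arg z
  have h2 := lt_of_le_of_ne (Complex.arg_le_pi z) (Complex.slitPlane_arg_ne_pi hz)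
  have h3 : (Complex.log z / 2).im = Complex.arg z / 2 := by
    simp [Complex.log_im]
  rw [h3]
  constructor <;> linarith

theorem log_csqrt {z : ℂ} (hz : z ≠ 0) : Complex.log (csqrt z) = Complex.log z / 2 := by
  have h1 := Complex.neg_pi_lt_arg z
  have h2 := Complex.arg_le_pi z
  have h3 : (Complex.log z / 2).im = Complex.arg z / 2 := by
    simp [Complex.log_im]
  have hpi := Real.pi_pos
  rw [csqrt_eq_exp hz, Complex.log_exp] <;> rw [h3] <;> linarith

theorem conj_csqrt {z : ℂ} (hz : z.arg ≠ Real.pi) :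
    (starRingEnd ℂ) (csqrt z) = csqrt ((starRingEnd ℂ) z) := by
  rw [csqrt, csqrt, Complex.conj_cpow _ _ hz]
  simp only [map_div₀, map_one, map_ofNat]

theorem csqrt_ofReal {a : ℝ} (ha : 0 < a) : csqrt (a : ℂ) = (Real.sqrt a : ℂ) := by
  rw [csqrt, Real.sqrt_eq_rpow, Complex.ofReal_cpow ha.le]
  push_cast
  rfl

theorem csqrt_ofReal_of_neg {a : ℝ} (ha : a < 0) :
    csqrt (a : ℂ) = Complex.I * (Real.sqrt (-a) : ℂ) := by
  have h0 : (a : ℂ) ≠ 0 := by exact_mod_cast ha.ne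
  have hlog : Complex.log (a : ℂ) = (Real.log (-a) : ℂ) + Real.pi * Complex.I := by
    rw [Complex.log, Complex.arg_ofReal_of_neg ha, Complex.norm_real, Real.norm_eq_abs,
      abs_of_neg ha]
  have hb : (Real.sqrt (-a) : ℂ) = Complex.exp ((Real.log (-a) : ℂ) / 2) := by
    rw [Real.sqrt_eq_rpow, Real.rpow_def_of_pos (by linarith)]
    push_cast
    congr 1
    ring
  rw [csqrt_eq_exp h0, hlog, hb, add_div, Complex.exp_add,
    show (Real.pi : ℂ) * Complex.I / 2 = Real.pi / 2 * Complex.I by ring,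
    Complex.exp_pi_div_two_mul_I]
  ring

namespace Admissible

variable {lam mu mus : ℝ}

theorem lam_two_mu_pos (h : Admissible lam mu mus) : 0 < lam + 2 * mu := by
  linarith [h.mu_pos, h.lam_mu_pos]

theorem q_eq (lam mu mus : ℝ) :
    q lam mu mus = p lam mu mus ^ 2 - 4 * (mus * (lam + 2 * mu)) ^ 2 := by
  simp only [q, p]; ring

/-- The middle coefficient of the characteristic polynomial, in the form in which it arises from the
determinant of the symbol. -/
theorem neg_p_eq (lam mu mus : ℝ) :
    -p lam mu mus = (lam + 2 * mu) ^ 2 + mus ^ 2 - (lam + mus) ^ 2 := by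
  simp only [p]; ring

theorem q_ne_zero (h : Admissible lam mu mus) : q lam mu mus ≠ 0 := by
  have h1 := h.mu_pos
  have h2 := h.lam_mu_pos
  have h3 := h.mus_pos
  have h4 : mu - mus ≠ 0 := sub_ne_zero.2 h.mus_ne.symm
  have h5 : lam + mu + mus ≠ 0 := by linarith
  simp only [q]
  exact mul_ne_zero (mul_ne_zero (mul_ne_zero (by positivity) h4) h2.ne') h5

theorem sqrtq_sq (lam mu mus : ℝ) : sqrtq lam mu mus ^ 2 = (q lam mu mus : ℂ) := csqrt_sq _

theorem sqrtq_ne_zero (h : Admissible lam mu mus) : sqrtq lam mu mus ≠ 0 := by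
  intro h0
  have := sqrtq_sq lam mu mus
  rw [h0] at this
  exact h.q_ne_zero (by exact_mod_cast (by simpa using this.symm))

/-- For positive `q` the number `-p` is positive as well, because then `mus < mu`. -/
theorem sqrt_q_lt (h : Admissible lam mu mus) (hq : 0 < q lam mu mus) :
    Real.sqrt (q lam mu mus) < -p lam mu mus := by
  have h1 := h.mu_pos
  have h2 := h.lam_mu_pos
  have h3 := h.mus_pos
  have h4 := h.lam_two_mu_pos
  have hlt : 0 < mu - mus := by
    by_contra hle
    have : q lam mu mus ≤ 0 := by
      have h5 : 0 < 16 * mu * (lam + mu) * (lam + mu + mus) := by positivity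
      have h6 : q lam mu mus = 16 * mu * (lam + mu) * (lam + mu + mus) * (mu - mus) := by
        simp only [q]; ring
      rw [h6]
      exact mul_nonpos_of_nonneg_of_nonpos h5.le (not_lt.1 hle)
    linarith
  have hp : 0 < -p lam mu mus := by
    have : -p lam mu mus = 4 * (lam + mu) * (mu - mus) + 2 * (mus * (lam + 2 * mu)) := by
      simp only [p]; ring
    rw [this]
    positivity
  rw [Real.sqrt_lt' hp, q_eq]
  have : 0 < (mus * (lam + 2 * mu)) ^ 2 := by positivity
  nlinarith

/-- The radicands of the two roots lie off the branch cut. -/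
theorem radicand_mem_slitPlane (h : Admissible lam mu mus) (m : Fin 2) :
    (if m = 0 then -(p lam mu mus : ℂ) - sqrtq lam mu mus
      else -(p lam mu mus : ℂ) + sqrtq lam mu mus) ∈ Complex.slitPlane := by
  rcases lt_or_gt_of_ne h.q_ne_zero with hq | hq
  · have h1 : Real.sqrt (-q lam mu mus) ≠ 0 := (Real.sqrt_pos.2 (by linarith)).ne'
    rw [sqrtq, csqrt_ofReal_of_neg hq, Complex.mem_slitPlane_iff]
    right
    split_ifs <;> simpa using h1
  · have h1 := h.sqrt_q_lt hq
    have h2 := Real.sqrt_nonneg (q lam mu mus)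
    rw [sqrtq, csqrt_ofReal hq, Complex.mem_slitPlane_iff]
    left
    split_ifs
    · simpa using h1
    · simp only [Complex.add_re, Complex.neg_re, Complex.ofReal_re]
      linarith

theorem s_eq (h : Admissible lam mu mus) (m : Fin 2) : s lam mu mus m =
    (((Real.sqrt (2 * mus * (lam + 2 * mu)))⁻¹ : ℝ) : ℂ) *
      csqrt (if m = 0 then -(p lam mu mus : ℂ) - sqrtq lam mu mus
        else -(p lam mu mus : ℂ) + sqrtq lam mu mus) := by
  have h1 : 0 < 2 * mus * (lam + 2 * mu) :=
    mul_pos (mul_pos two_pos h.mus_pos) h.lam_two_mu_pos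
  rw [s, csqrt_ofReal h1]
  push_cast
  rw [one_div]

theorem s_re_pos (h : Admissible lam mu mus) (m : Fin 2) : 0 < (s lam mu mus m).re := by
  have h1 : 0 < 2 * mus * (lam + 2 * mu) :=
    mul_pos (mul_pos two_pos h.mus_pos) h.lam_two_mu_pos
  rw [h.s_eq, Complex.re_ofReal_mul]
  exact mul_pos (inv_pos.2 (Real.sqrt_pos.2 h1)) (csqrt_re_pos (h.radicand_mem_slitPlane m))

theorem s_ne_zero (h : Admissible lam mu mus) (m : Fin 2) : s lam mu mus m ≠ 0 := fun h0 => by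
  have := h.s_re_pos m
  simp [h0] at this

theorem s_sq (h : Admissible lam mu mus) (m : Fin 2) :
    2 * (mus * (lam + 2 * mu)) * s lam mu mus m ^ 2 =
      if m = 0 then -(p lam mu mus : ℂ) - sqrtq lam mu mus
        else -(p lam mu mus : ℂ) + sqrtq lam mu mus := by
  have h1 : 0 < 2 * mus * (lam + 2 * mu) :=
    mul_pos (mul_pos two_pos h.mus_pos) h.lam_two_mu_pos
  have h2 : ((2 * mus * (lam + 2 * mu) : ℝ) : ℂ) ≠ 0 := by exact_mod_cast h1.ne'
  rw [s, mul_pow, csqrt_sq, div_pow, csqrt_sq, one_pow]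
  field_simp
  push_cast
  ring

/-- `s₁` and `s₂` are roots of `A B s⁴ + p s² + A B`, where `A = λ + 2μ` and `B = μ*`. -/
theorem char_poly (h : Admissible lam mu mus) (m : Fin 2) :
    mus * (lam + 2 * mu) * s lam mu mus m ^ 4 + p lam mu mus * s lam mu mus m ^ 2
      + mus * (lam + 2 * mu) = 0 := by
  have hs := h.s_sq m
  have hq := sqrtq_sq lam mu mus
  rw [q_eq] at hq
  push_cast at hq
  have hAB : (mus * (lam + 2 * mu) : ℂ) ≠ 0 := by
    exact_mod_cast (mul_pos h.mus_pos h.lam_two_mu_pos).ne'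
  have h4 : (4 * (mus * (lam + 2 * mu)) : ℂ) ≠ 0 := mul_ne_zero (by norm_num) hAB
  refine mul_left_cancel₀ h4 ?_
  set S := s lam mu mus m
  have hr : (2 * (mus * (lam + 2 * mu)) * S ^ 2 + p lam mu mus) ^ 2 = sqrtq lam mu mus ^ 2 := by
    rw [hs]; split_ifs <;> ring
  linear_combination hr + hq

theorem s_sq_sub (h : Admissible lam mu mus) :
    mus * (lam + 2 * mu) * (s lam mu mus 0 ^ 2 - s lam mu mus 1 ^ 2) = -sqrtq lam mu mus := by
  have h0 := h.s_sq 0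
  have h1 := h.s_sq 1
  simp only [if_true, one_ne_zero, if_false] at h0 h1
  linear_combination (h0 - h1) / 2

theorem s_sq_add (h : Admissible lam mu mus) :
    mus * (lam + 2 * mu) * (s lam mu mus 0 ^ 2 + s lam mu mus 1 ^ 2) = -p lam mu mus := by
  have h0 := h.s_sq 0
  have h1 := h.s_sq 1
  simp only [if_true, one_ne_zero, if_false] at h0 h1
  linear_combination (h0 + h1) / 2

theorem s_sq_mul (h : Admissible lam mu mus) :
    s lam mu mus 0 ^ 2 * s lam mu mus 1 ^ 2 = 1 := by
  have h0 := h.char_poly 0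
  have hAB : (mus * (lam + 2 * mu) : ℂ) ≠ 0 := by
    exact_mod_cast (mul_pos h.mus_pos h.lam_two_mu_pos).ne'
  refine mul_left_cancel₀ hAB ?_
  linear_combination s lam mu mus 0 ^ 2 * h.s_sq_add - h0

/-- If `q > 0`, then all quantities are real. -/
theorem conj_of_q_pos (h : Admissible lam mu mus) (hq : 0 < q lam mu mus) :
    (starRingEnd ℂ) (sqrtq lam mu mus) = sqrtq lam mu mus ∧
      ∀ m, (starRingEnd ℂ) (s lam mu mus m) = s lam mu mus m := by
  have h1 : (starRingEnd ℂ) (sqrtq lam mu mus) = sqrtq lam mu mus := by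
    rw [sqrtq, csqrt_ofReal hq, Complex.conj_ofReal]
  refine ⟨h1, fun m => ?_⟩
  rw [h.s_eq, map_mul, Complex.conj_ofReal,
    conj_csqrt (Complex.slitPlane_arg_ne_pi (h.radicand_mem_slitPlane m))]
  split_ifs <;> simp [h1]

/-- If `q < 0`, then conjugation changes the sign of `√q` and hence interchanges the two roots. -/
theorem conj_of_q_neg (h : Admissible lam mu mus) (hq : q lam mu mus < 0) :
    (starRingEnd ℂ) (sqrtq lam mu mus) = -sqrtq lam mu mus ∧
      (starRingEnd ℂ) (s lam mu mus 0) = s lam mu mus 1 ∧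
      (starRingEnd ℂ) (s lam mu mus 1) = s lam mu mus 0 := by
  have h1 : (starRingEnd ℂ) (sqrtq lam mu mus) = -sqrtq lam mu mus := by
    rw [sqrtq, csqrt_ofReal_of_neg hq]
    simp
  have h2 : (starRingEnd ℂ) (s lam mu mus 0) = s lam mu mus 1 := by
    rw [h.s_eq, h.s_eq, map_mul, Complex.conj_ofReal,
      conj_csqrt (Complex.slitPlane_arg_ne_pi (h.radicand_mem_slitPlane 0))]
    simp [h1]
  exact ⟨h1, h2, by rw [← h2, Complex.conj_conj]⟩

end Admissible

/-! ### The weak equilibrium equations against complex test functions -/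

theorem pd_eq (i : Fin 2) (f : ℝ × ℝ → ℝ) (x : ℝ × ℝ) : pd i f x = fderiv ℝ f x (basisVec i) := rfl

theorem ae_ne_zero : ∀ᵐ x : ℝ × ℝ, x ≠ 0 := by simp [ae_iff]

theorem pairing_eq_of_eq_lincomb {f g k : ℝ × ℝ → ℂ} (hf : LocallyIntegrable f)
    (hg : LocallyIntegrable g) (hk : LocallyIntegrable k) (a b : ℂ)
    (h : ∀ x ≠ 0, f x = a * g x + b * k x) (ψ : TestFun) :
    pairing f hf ψ = a * pairing g hg ψ + b * pairing k hk ψ := by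
  simp only [pairing_apply]
  rw [← integral_const_mul, ← integral_const_mul,
    ← integral_add ((integrable_mul_testFun hg ψ).const_mul a)
      ((integrable_mul_testFun hk ψ).const_mul b)]
  refine integral_congr_ae ?_
  filter_upwards [ae_ne_zero] with x hx
  rw [h x hx]
  ring

theorem pairing_eq_of_eq_const_mul {f g : ℝ × ℝ → ℂ} (hf : LocallyIntegrable f)
    (hg : LocallyIntegrable g) (a : ℂ) (h : ∀ x ≠ 0, f x = a * g x) (ψ : TestFun) :
    pairing f hf ψ = a * pairing g hg ψ := by
  have := pairing_eq_of_eq_lincomb hf hg hg a 0 (fun x hx => by rw [h x hx]; ring) ψ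
  rwa [zero_mul, add_zero] at this

/-- The equilibrium equations under the force `F δ` for a pair of distributions. -/
def WeakEquilibrium (lam mu mus : ℝ) (F : Fin 2 → ℝ) (T : Fin 2 → TestFun →ₗ[ℂ] ℂ) : Prop :=
  ∀ ψ : TestFun,
    (lam + 2 * mu) * T 0 (TestFun.d 0 (TestFun.d 0 ψ)) + mus * T 0 (TestFun.d 1 (TestFun.d 1 ψ))
      + (lam + mus) * T 1 (TestFun.d 0 (TestFun.d 1 ψ)) + F 0 * ψ.1 0 = 0 ∧
    (lam + 2 * mu) * T 1 (TestFun.d 1 (TestFun.d 1 ψ)) + mus * T 1 (TestFun.d 0 (TestFun.d 0 ψ))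
      + (lam + mus) * T 0 (TestFun.d 0 (TestFun.d 1 ψ)) + F 1 * ψ.1 0 = 0

theorem locallyIntegrable_ofReal {f : ℝ × ℝ → ℝ} (hf : LocallyIntegrable f) :
    LocallyIntegrable fun x => (f x : ℂ) := fun x =>
  let ⟨U, hU, h⟩ := hf x
  ⟨U, hU, h.ofReal⟩

theorem contDiff_pd {φ : ℝ × ℝ → ℝ} (h : ContDiff ℝ ∞ φ) (i : Fin 2) : ContDiff ℝ ∞ (pd i φ) :=
  (h.fderiv_right (m := ∞) (by simp)).clm_apply contDiff_const

theorem hasCompactSupport_pd {φ : ℝ × ℝ → ℝ} (h : HasCompactSupport φ) (i : Fin 2) :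
    HasCompactSupport (pd i φ) :=
  h.fderiv_apply (𝕜 := ℝ) (basisVec i)

theorem TestFun.d_ofReal {φ : ℝ × ℝ → ℝ} (h : ContDiff ℝ ∞ φ) (hc : HasCompactSupport φ)
    (i : Fin 2) : TestFun.d i (TestFun.ofReal φ h hc)
      = TestFun.ofReal (pd i φ) (contDiff_pd h i) (hasCompactSupport_pd hc i) := by
  ext x
  have hd : HasFDerivAt (fun x => (φ x : ℂ)) (Complex.ofRealCLM.comp (fderiv ℝ φ x)) x :=
    Complex.ofRealCLM.hasFDerivAt.comp x (h.differentiable (by simp) x).hasFDerivAt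
  rw [TestFun.d_apply, TestFun.ofReal_apply]
  change fderiv ℝ (fun x => (φ x : ℂ)) x (basisVec i) = _
  rw [hd.fderiv]
  rfl

theorem pairing_ofReal {f : ℝ × ℝ → ℝ} (hf : LocallyIntegrable fun x => (f x : ℂ)) {φ : ℝ × ℝ → ℝ}
    (h : ContDiff ℝ ∞ φ) (hc : HasCompactSupport φ) :
    pairing _ hf (TestFun.ofReal φ h hc)
      = ((∫ x, f x * φ x : ℝ) : ℂ) := by
  rw [pairing_apply]
  refine Eq.trans ?_ (integral_ofReal (𝕜 := ℂ) (f := fun x => f x * φ x))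
  refine integral_congr_ae (Eventually.of_forall fun x => ?_)
  simp [TestFun.ofReal_apply]

theorem integrable_mul_of_hasCompactSupport {f φ : ℝ × ℝ → ℝ} (hf : LocallyIntegrable f)
    (h : ContDiff ℝ ∞ φ) (hc : HasCompactSupport φ) : Integrable fun x => f x * φ x := by
  simpa [smul_eq_mul] using hf.integrable_smul_right_of_hasCompactSupport h.continuous hc

/-- A complex test function is a combination of two real ones. -/
theorem TestFun.eq_re_add_im (ψ : TestFun) :
    ∃ (φ χ : ℝ × ℝ → ℝ) (h : ContDiff ℝ ∞ φ) (hc : HasCompactSupport φ) (k : ContDiff ℝ ∞ χ)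
      (kc : HasCompactSupport χ),
      ψ = TestFun.ofReal φ h hc + Complex.I • TestFun.ofReal χ k kc := by
  refine ⟨fun x => (ψ.1 x).re, fun x => (ψ.1 x).im, Complex.reCLM.contDiff.comp ψ.contDiff,
    ψ.hasCompactSupport.comp_left (g := Complex.re) Complex.zero_re,
    Complex.imCLM.contDiff.comp ψ.contDiff,
    ψ.hasCompactSupport.comp_left (g := Complex.im) Complex.zero_im, ?_⟩
  ext x
  change ψ.1 x = ((ψ.1 x).re : ℂ) + Complex.I * ((ψ.1 x).im : ℂ)
  rw [mul_comm, Complex.re_add_im]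

theorem solvesEquilibrium_iff {lam mu mus : ℝ} {F : Fin 2 → ℝ} {u : Displacement}
    (hu : ∀ k, LocallyIntegrable (u k)) : SolvesEquilibrium lam mu mus F u ↔
      WeakEquilibrium lam mu mus F fun k => pairing _ (locallyIntegrable_ofReal (hu k)) := by
  have key : ∀ (φ : ℝ × ℝ → ℝ) (h : ContDiff ℝ ∞ φ) (hc : HasCompactSupport φ) (k l : Fin 2)
      (i j : Fin 2) (a b c : ℝ),
      ((∫ x : ℝ × ℝ, (u k x * (a * pd i (pd i φ) x + b * pd j (pd j φ) x)
        + u l x * (c * pd 0 (pd 1 φ) x)) : ℝ) : ℂ)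
      = a * pairing _ (locallyIntegrable_ofReal (hu k))
          (TestFun.d i (TestFun.d i (TestFun.ofReal φ h hc)))
        + b * pairing _ (locallyIntegrable_ofReal (hu k))
          (TestFun.d j (TestFun.d j (TestFun.ofReal φ h hc)))
        + c * pairing _ (locallyIntegrable_ofReal (hu l))
          (TestFun.d 0 (TestFun.d 1 (TestFun.ofReal φ h hc))) := by
    intro φ h hc k l i j a b c
    have hint : ∀ m i j, Integrable fun x => u m x * pd i (pd j φ) x := fun m i j =>
      integrable_mul_of_hasCompactSupport (hu m) (contDiff_pd (contDiff_pd h j) i)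
        (hasCompactSupport_pd (hasCompactSupport_pd hc j) i)
    have h12 : Integrable fun x => a * (u k x * pd i (pd i φ) x) + b * (u k x * pd j (pd j φ) x) :=
      ((hint k i i).const_mul a).add ((hint k j j).const_mul b)
    simp only [TestFun.d_ofReal, pairing_ofReal]
    rw [← Complex.ofReal_mul, ← Complex.ofReal_mul, ← Complex.ofReal_mul, ← Complex.ofReal_add,
      ← Complex.ofReal_add, ← integral_const_mul, ← integral_const_mul, ← integral_const_mul,
      ← integral_add ((hint k i i).const_mul a) ((hint k j j).const_mul b),
      ← integral_add h12 ((hint l 0 1).const_mul c)]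
    congr 1
    refine integral_congr_ae (Eventually.of_forall fun x => ?_)
    simp only
    ring
  have hreal : ∀ (φ : ℝ × ℝ → ℝ) (h : ContDiff ℝ ∞ φ) (hc : HasCompactSupport φ),
      ((∫ x : ℝ × ℝ, (u 0 x * ((lam + 2 * mu) * pd 0 (pd 0 φ) x + mus * pd 1 (pd 1 φ) x)
          + u 1 x * ((lam + mus) * pd 0 (pd 1 φ) x))) + F 0 * φ 0 = 0 ∧
      (∫ x : ℝ × ℝ, (u 1 x * ((lam + 2 * mu) * pd 1 (pd 1 φ) x + mus * pd 0 (pd 0 φ) x)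
          + u 0 x * ((lam + mus) * pd 0 (pd 1 φ) x))) + F 1 * φ 0 = 0) ↔
      (((lam + 2 * mu : ℝ) : ℂ) * pairing _ (locallyIntegrable_ofReal (hu 0))
          (TestFun.d 0 (TestFun.d 0 (TestFun.ofReal φ h hc)))
        + mus * pairing _ (locallyIntegrable_ofReal (hu 0))
          (TestFun.d 1 (TestFun.d 1 (TestFun.ofReal φ h hc)))
        + ((lam + mus : ℝ) : ℂ) * pairing _ (locallyIntegrable_ofReal (hu 1))
          (TestFun.d 0 (TestFun.d 1 (TestFun.ofReal φ h hc))) + F 0 * (φ 0 : ℂ) = 0 ∧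
      ((lam + 2 * mu : ℝ) : ℂ) * pairing _ (locallyIntegrable_ofReal (hu 1))
          (TestFun.d 1 (TestFun.d 1 (TestFun.ofReal φ h hc)))
        + mus * pairing _ (locallyIntegrable_ofReal (hu 1))
          (TestFun.d 0 (TestFun.d 0 (TestFun.ofReal φ h hc)))
        + ((lam + mus : ℝ) : ℂ) * pairing _ (locallyIntegrable_ofReal (hu 0))
          (TestFun.d 0 (TestFun.d 1 (TestFun.ofReal φ h hc))) + F 1 * (φ 0 : ℂ) = 0) := by
    intro φ h hc
    rw [← key φ h hc, ← key φ h hc]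
    norm_cast
  constructor
  · intro hS ψ
    obtain ⟨φ, χ, h, hc, k, kc, rfl⟩ := ψ.eq_re_add_im
    have h1 := (hreal φ h hc).1 (hS φ h hc)
    have h2 := (hreal χ k kc).1 (hS χ k kc)
    push_cast at h1 h2
    have hval : (TestFun.ofReal φ h hc + Complex.I • TestFun.ofReal χ k kc).1 0
        = (φ 0 : ℂ) + Complex.I * (χ 0 : ℂ) := rfl
    rw [hval]
    simp only [map_add, map_smul, smul_eq_mul]
    exact ⟨by linear_combination h1.1 + Complex.I * h2.1,
      by linear_combination h1.2 + Complex.I * h2.2⟩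
  · intro hW φ h hc
    refine (hreal φ h hc).2 ?_
    have := hW (TestFun.ofReal φ h hc)
    rw [TestFun.ofReal_apply] at this
    push_cast
    exact this

/-- A real valued field with logarithmic singularity that solves the weak equations is a
displacement field: its strain decays like `1 / ‖x‖`. -/
theorem isPointForceDisplacement_realField {lam mu mus : ℝ} {F : Fin 2 → ℝ}
    {w : Fin 2 → ℝ × ℝ → ℂ} {w' : Fin 2 → Fin 2 → ℝ × ℝ → ℂ} (hw : ∀ k, IsLogType (w k) (w' k))
    (him : ∀ k x, x ≠ 0 → (w k x).im = 0)
    (heq : WeakEquilibrium lam mu mus F fun k => pairing _ (hw k).locallyIntegrable) :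
    IsPointForceDisplacement lam mu mus F (realField w) := by
  have hloc : ∀ k, LocallyIntegrable (realField w k) := fun k x =>
    let ⟨U, hU, h⟩ := (hw k).locallyIntegrable x
    ⟨U, hU, h.re⟩
  have hpd : ∀ k l x, x ≠ 0 → pd l (realField w k) x = (w' k l x).re := by
    intro k l x hx
    obtain ⟨L, hL, hi⟩ := (hw k).hasFDerivAt x hx
    have : HasFDerivAt (realField w k) (Complex.reCLM.comp L) x :=
      Complex.reCLM.hasFDerivAt.comp x hL
    rw [pd_eq, this.fderiv, ← hi l]
    rfl
  refine ⟨hloc, fun k => Complex.reCLM.contDiff.comp_contDiffOn (hw k).contDiffOn,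
    (solvesEquilibrium_iff hloc).2 ?_, fun k l => ?_⟩
  · intro ψ
    have hT : ∀ k (χ : TestFun), pairing _ (locallyIntegrable_ofReal (hloc k)) χ
        = pairing _ (hw k).locallyIntegrable χ := by
      intro k χ
      simp only [pairing_apply]
      refine integral_congr_ae ?_
      filter_upwards [ae_ne_zero] with x hx
      congr 1
      apply Complex.ext
      · rfl
      · simp [him k x hx]
    simp only [hT]
    exact heq ψ
  · obtain ⟨C, hC⟩ := (hw k).bound_deriv
    obtain ⟨D, hD⟩ := (hw l).bound_deriv
    have hlim : Tendsto (fun x : ℝ × ℝ => (C + D) * ‖x‖⁻¹) (cocompact (ℝ × ℝ)) (𝓝 0) := by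
      simpa using (tendsto_inv_atTop_zero.comp
        (tendsto_norm_cocompact_atTop (E := ℝ × ℝ))).const_mul (C + D)
    refine squeeze_zero_norm' ?_ hlim
    have hne : ∀ᶠ x : ℝ × ℝ in cocompact (ℝ × ℝ), x ≠ 0 :=
      (isCompact_singleton (x := (0 : ℝ × ℝ))).compl_mem_cocompact
    filter_upwards [hne] with x hx
    rw [strain, hpd k l x hx, hpd l k x hx, Real.norm_eq_abs, abs_div, abs_two]
    have h1 := (Complex.abs_re_le_norm _).trans (hC l x hx)
    have h2 := (Complex.abs_re_le_norm _).trans (hD k x hx)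
    have h3 := abs_add_le (w' k l x).re (w' l k x).re
    have h4 := abs_nonneg ((w' k l x).re + (w' l k x).re)
    linarith

/-! ### The closed-form fields -/

namespace Admissible

variable {lam mu mus : ℝ}

/-- The logarithm of the quadratic form belonging to the root `s_m`. -/
theorem isLogType_log (h : Admissible lam mu mus) (m : Fin 2) :
    IsLogType (fun x => Complex.log (quadForm (s lam mu mus m) x))
      (logQuadDeriv (s lam mu mus m)) :=
  isLogType_log_quadForm (h.s_re_pos m)

theorem isLogType_angle (h : Admissible lam mu mus) :
    IsLogType (angleDiff (s lam mu mus 0) (s lam mu mus 1))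
      (angleDiffDeriv (s lam mu mus 0) (s lam mu mus 1)) :=
  isLogType_angleDiff (h.s_re_pos 0) (h.s_re_pos 1)

theorem log_r (h : Admissible lam mu mus) (m : Fin 2) {x : ℝ × ℝ} (hx : x ≠ 0) :
    Complex.log (r lam mu mus m x) = Complex.log (quadForm (s lam mu mus m) x) / 2 :=
  log_csqrt (quadForm_ne_zero (h.s_re_pos m) hx)

theorem θ_sub (h : Admissible lam mu mus) (x : ℝ × ℝ) :
    θ lam mu mus 1 x - θ lam mu mus 0 x = angleDiff (s lam mu mus 0) (s lam mu mus 1) x := by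
  by_cases hx : x.1 = 0
  · rw [angleDiff_of_fst_eq_zero hx]
    simp [θ, hx]
  · rw [angleDiff_eq_arctan_sub (h.s_re_pos 0) (h.s_re_pos 1) hx]
    rfl

theorem pairing_log_d (h : Admissible lam mu mus) (m : Fin 2) (ψ : TestFun) :
    pairing _ (h.isLogType_log m).locallyIntegrable (TestFun.d 1 (TestFun.d 1 ψ))
      = 4 * Real.pi * s lam mu mus m * ψ.1 0 - s lam mu mus m ^ 2 *
        pairing _ (h.isLogType_log m).locallyIntegrable (TestFun.d 0 (TestFun.d 0 ψ)) :=
  eq_sub_of_add_eq (pairing_log_quadForm (h.s_re_pos m) ψ)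

theorem pairing_angle_d_zero (h : Admissible lam mu mus) (ψ : TestFun) :
    pairing _ h.isLogType_angle.locallyIntegrable (TestFun.d 0 ψ)
      = 1 / (2 * s lam mu mus 0) * pairing _ (h.isLogType_log 0).locallyIntegrable (TestFun.d 1 ψ)
        - 1 / (2 * s lam mu mus 1)
          * pairing _ (h.isLogType_log 1).locallyIntegrable (TestFun.d 1 ψ) := by
  rw [h.isLogType_angle.pairing_d, (h.isLogType_log 0).pairing_d, (h.isLogType_log 1).pairing_d,
    pairing_eq_of_eq_lincomb _ ((h.isLogType_log 0).locallyIntegrable_deriv 1)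
      ((h.isLogType_log 1).locallyIntegrable_deriv 1) (1 / (2 * s lam mu mus 0))
      (-(1 / (2 * s lam mu mus 1)))]
  · ring
  · intro x _
    simp only [angleDiffDeriv, Matrix.cons_val_zero]
    ring

theorem pairing_angle_d_one (h : Admissible lam mu mus) (ψ : TestFun) :
    pairing _ h.isLogType_angle.locallyIntegrable (TestFun.d 1 ψ)
      = s lam mu mus 1 / 2 * pairing _ (h.isLogType_log 1).locallyIntegrable (TestFun.d 0 ψ)
        - s lam mu mus 0 / 2
          * pairing _ (h.isLogType_log 0).locallyIntegrable (TestFun.d 0 ψ) := by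
  rw [h.isLogType_angle.pairing_d, (h.isLogType_log 0).pairing_d, (h.isLogType_log 1).pairing_d,
    pairing_eq_of_eq_lincomb _ ((h.isLogType_log 1).locallyIntegrable_deriv 0)
      ((h.isLogType_log 0).locallyIntegrable_deriv 0) (s lam mu mus 1 / 2)
      (-(s lam mu mus 0 / 2))]
  · ring
  · intro x _
    simp only [angleDiffDeriv, Matrix.cons_val_one, Matrix.cons_val_zero]
    ring

theorem Y1_mul_s (h : Admissible lam mu mus) (m : Fin 2) :
    Y1 lam mu mus m * s lam mu mus m = (lam + 2 * mu) * s lam mu mus m ^ 2 - mus := by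
  rw [Y1, div_mul_cancel₀ _ (h.s_ne_zero m)]
  push_cast
  rfl

theorem Y2_mul_s (h : Admissible lam mu mus) (m : Fin 2) :
    Y2 lam mu mus m * s lam mu mus m = mus * s lam mu mus m ^ 2 - (lam + 2 * mu) := by
  rw [Y2, div_mul_cancel₀ _ (h.s_ne_zero m)]
  push_cast
  rfl

theorem Y1_eq (h : Admissible lam mu mus) (m : Fin 2) :
    Y1 lam mu mus m = (lam + 2 * mu) * s lam mu mus m - mus / s lam mu mus m := by
  have := h.s_ne_zero m
  rw [Y1]
  push_cast
  field_simp

theorem Y2_eq (h : Admissible lam mu mus) (m : Fin 2) :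
    Y2 lam mu mus m = mus * s lam mu mus m - (lam + 2 * mu) / s lam mu mus m := by
  have := h.s_ne_zero m
  rw [Y2]
  push_cast
  field_simp

theorem p_eq_complex (lam mu mus : ℝ) :
    (p lam mu mus : ℂ) = -((lam + 2 * mu) ^ 2 + mus ^ 2 - (lam + mus) ^ 2) := by
  have := neg_p_eq lam mu mus
  exact_mod_cast (by linarith : p lam mu mus = -((lam + 2 * mu) ^ 2 + mus ^ 2 - (lam + mus) ^ 2))

/-- The vector `(Y_m^{(1)}, i (λ + μ*))` lies in the kernel of the symbol at `ξ = (1, i s_m)`: the first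
of the two equations that say so. -/
theorem Y1_mul (h : Admissible lam mu mus) (m : Fin 2) :
    Y1 lam mu mus m * (lam + 2 * mu - mus * s lam mu mus m ^ 2)
      = (lam + mus) ^ 2 * s lam mu mus m := by
  refine mul_right_cancel₀ (h.s_ne_zero m) ?_
  have hc := h.char_poly m
  rw [p_eq_complex] at hc
  linear_combination (lam + 2 * mu - mus * s lam mu mus m ^ 2) * h.Y1_mul_s m - hc

/-- The second component equation for the kernel vector `(i (λ + μ*), Y_m^{(2)})` of the symbol at
`ξ = (1, i s_m)`. -/
theorem Y2_mul (h : Admissible lam mu mus) (m : Fin 2) :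
    Y2 lam mu mus m * (mus - (lam + 2 * mu) * s lam mu mus m ^ 2)
      = (lam + mus) ^ 2 * s lam mu mus m := by
  refine mul_right_cancel₀ (h.s_ne_zero m) ?_
  have hc := h.char_poly m
  rw [p_eq_complex] at hc
  linear_combination (mus - (lam + 2 * mu) * s lam mu mus m ^ 2) * h.Y2_mul_s m - hc

theorem uP1_zero_eq (h : Admissible lam mu mus) (P : ℝ) {x : ℝ × ℝ} (hx : x ≠ 0) :
    uP1 lam mu mus P 0 x =
      (P / (2 * Real.pi * sqrtq lam mu mus) * (Y1 lam mu mus 0 / 2)) *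
          Complex.log (quadForm (s lam mu mus 0) x)
        + (-(P / (2 * Real.pi * sqrtq lam mu mus) * (Y1 lam mu mus 1 / 2))) *
          Complex.log (quadForm (s lam mu mus 1) x) := by
  simp only [uP1, Matrix.cons_val_zero, h.log_r _ hx]
  ring

theorem uP1_one_eq (h : Admissible lam mu mus) (P : ℝ) (x : ℝ × ℝ) :
    uP1 lam mu mus P 1 x =
      P / (2 * Real.pi * sqrtq lam mu mus) * (lam + mus) *
        angleDiff (s lam mu mus 0) (s lam mu mus 1) x := by
  simp only [uP1, Matrix.cons_val_one, Matrix.cons_val_zero, h.θ_sub]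
  push_cast
  ring

theorem uP2_zero_eq (h : Admissible lam mu mus) (P : ℝ) (x : ℝ × ℝ) :
    uP2 lam mu mus P 0 x =
      P / (2 * Real.pi * sqrtq lam mu mus) * (lam + mus) *
        angleDiff (s lam mu mus 0) (s lam mu mus 1) x := by
  simp only [uP2, Matrix.cons_val_zero, h.θ_sub]
  push_cast
  ring

theorem uP2_one_eq (h : Admissible lam mu mus) (P : ℝ) {x : ℝ × ℝ} (hx : x ≠ 0) :
    uP2 lam mu mus P 1 x =
      (P / (2 * Real.pi * sqrtq lam mu mus) * (Y2 lam mu mus 0 / 2)) *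
          Complex.log (quadForm (s lam mu mus 0) x)
        + (-(P / (2 * Real.pi * sqrtq lam mu mus) * (Y2 lam mu mus 1 / 2))) *
          Complex.log (quadForm (s lam mu mus 1) x) := by
  simp only [uP2, Matrix.cons_val_one, Matrix.cons_val_zero, h.log_r _ hx]
  ring

theorem exists_isLogType_uP1 (h : Admissible lam mu mus) (P : ℝ) (k : Fin 2) :
    ∃ f', IsLogType (uP1 lam mu mus P k) f' := by
  fin_cases k
  · exact ⟨_, (((h.isLogType_log 0).const_mul _).add ((h.isLogType_log 1).const_mul _)).congr
      fun x hx => h.uP1_zero_eq P hx⟩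
  · exact ⟨_, (h.isLogType_angle.const_mul _).congr fun x _ => h.uP1_one_eq P x⟩

theorem exists_isLogType_uP2 (h : Admissible lam mu mus) (P : ℝ) (k : Fin 2) :
    ∃ f', IsLogType (uP2 lam mu mus P k) f' := by
  fin_cases k
  · exact ⟨_, (h.isLogType_angle.const_mul _).congr fun x _ => h.uP2_zero_eq P x⟩
  · exact ⟨_, (((h.isLogType_log 0).const_mul _).add ((h.isLogType_log 1).const_mul _)).congr
      fun x hx => h.uP2_one_eq P hx⟩

theorem conj_angle_div_sqrtq (h : Admissible lam mu mus) {x : ℝ × ℝ} (hx : x ≠ 0) :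
    (starRingEnd ℂ) (angleDiff (s lam mu mus 0) (s lam mu mus 1) x / sqrtq lam mu mus)
      = angleDiff (s lam mu mus 0) (s lam mu mus 1) x / sqrtq lam mu mus := by
  rw [map_div₀, conj_angleDiff (h.s_re_pos 0) (h.s_re_pos 1) hx]
  rcases lt_or_gt_of_ne h.q_ne_zero with hq | hq
  · obtain ⟨h1, h2, h3⟩ := h.conj_of_q_neg hq
    rw [h1, h2, h3, angleDiff_comm (h.s_re_pos 0) (h.s_re_pos 1) hx, neg_div_neg_eq]
  · obtain ⟨h1, h2⟩ := h.conj_of_q_pos hq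
    rw [h1, h2, h2]

/-- The amplitudes are taken to be the values at `s₁` and `s₂` of one function that commutes with
conjugation. -/
theorem conj_log_div_sqrtq (h : Admissible lam mu mus) {Y : Fin 2 → ℂ} {f : ℂ → ℂ}
    (hY : ∀ m, Y m = f (s lam mu mus m)) (hf : ∀ z, (starRingEnd ℂ) (f z) = f ((starRingEnd ℂ) z))
    {x : ℝ × ℝ} (hx : x ≠ 0) :
    (starRingEnd ℂ) ((Y 0 * Complex.log (quadForm (s lam mu mus 0) x)
      - Y 1 * Complex.log (quadForm (s lam mu mus 1) x)) / sqrtq lam mu mus)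
      = (Y 0 * Complex.log (quadForm (s lam mu mus 0) x)
      - Y 1 * Complex.log (quadForm (s lam mu mus 1) x)) / sqrtq lam mu mus := by
  rw [map_div₀, map_sub, map_mul, map_mul, conj_log_quadForm (h.s_re_pos 0) hx,
    conj_log_quadForm (h.s_re_pos 1) hx, hY, hY, hf, hf]
  rcases lt_or_gt_of_ne h.q_ne_zero with hq | hq
  · obtain ⟨h1, h2, h3⟩ := h.conj_of_q_neg hq
    rw [h1, h2, h3, ← neg_div_neg_eq, neg_neg, neg_sub]
  · obtain ⟨h1, h2⟩ := h.conj_of_q_pos hq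
    rw [h1, h2, h2]

theorem im_uP1 (h : Admissible lam mu mus) (P : ℝ) (k : Fin 2) {x : ℝ × ℝ} (hx : x ≠ 0) :
    (uP1 lam mu mus P k x).im = 0 := by
  rw [← Complex.conj_eq_iff_im]
  fin_cases k
  · have hc := h.conj_log_div_sqrtq (Y := Y1 lam mu mus)
      (f := fun z => (((lam + 2 * mu : ℝ) : ℂ) * z ^ 2 - (mus : ℂ)) / z) (fun m => rfl)
      (fun z => by
        simp only [map_div₀, map_sub, map_mul, map_pow, Complex.conj_ofReal]) hx
    have hu : uP1 lam mu mus P 0 x = ((P / (4 * Real.pi) : ℝ) : ℂ) *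
        ((Y1 lam mu mus 0 * Complex.log (quadForm (s lam mu mus 0) x)
          - Y1 lam mu mus 1 * Complex.log (quadForm (s lam mu mus 1) x)) / sqrtq lam mu mus) := by
      rw [h.uP1_zero_eq P hx]
      push_cast
      ring
    simp only [Fin.zero_eta]
    rw [hu, map_mul, Complex.conj_ofReal, hc]
  · have hu : uP1 lam mu mus P 1 x = ((P * (lam + mus) / (2 * Real.pi) : ℝ) : ℂ) *
        (angleDiff (s lam mu mus 0) (s lam mu mus 1) x / sqrtq lam mu mus) := by
      rw [h.uP1_one_eq P]
      push_cast
      ring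
    simp only [Fin.mk_one]
    rw [hu, map_mul, Complex.conj_ofReal, h.conj_angle_div_sqrtq hx]

theorem im_uP2 (h : Admissible lam mu mus) (P : ℝ) (k : Fin 2) {x : ℝ × ℝ} (hx : x ≠ 0) :
    (uP2 lam mu mus P k x).im = 0 := by
  rw [← Complex.conj_eq_iff_im]
  fin_cases k
  · have hu : uP2 lam mu mus P 0 x = ((P * (lam + mus) / (2 * Real.pi) : ℝ) : ℂ) *
        (angleDiff (s lam mu mus 0) (s lam mu mus 1) x / sqrtq lam mu mus) := by
      rw [h.uP2_zero_eq P]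
      push_cast
      ring
    simp only [Fin.zero_eta]
    rw [hu, map_mul, Complex.conj_ofReal, h.conj_angle_div_sqrtq hx]
  · have hc := h.conj_log_div_sqrtq (Y := Y2 lam mu mus)
      (f := fun z => ((mus : ℂ) * z ^ 2 - ((lam + 2 * mu : ℝ) : ℂ)) / z) (fun m => rfl)
      (fun z => by
        simp only [map_div₀, map_sub, map_mul, map_pow, Complex.conj_ofReal]) hx
    have hu : uP2 lam mu mus P 1 x = ((P / (4 * Real.pi) : ℝ) : ℂ) *
        ((Y2 lam mu mus 0 * Complex.log (quadForm (s lam mu mus 0) x)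
          - Y2 lam mu mus 1 * Complex.log (quadForm (s lam mu mus 1) x)) / sqrtq lam mu mus) := by
      rw [h.uP2_one_eq P hx]
      push_cast
      ring
    simp only [Fin.mk_one]
    rw [hu, map_mul, Complex.conj_ofReal, hc]

/-- The factor `1 / (2 π √q)` normalizes the point mass that the two logarithms produce together. -/
theorem normalization (h : Admissible lam mu mus) (P : ℝ) :
    P / (2 * Real.pi * sqrtq lam mu mus) * (2 * Real.pi *
      (mus * (lam + 2 * mu) * (s lam mu mus 0 ^ 2 - s lam mu mus 1 ^ 2))) = -P := by
  rw [h.s_sq_sub]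
  have h1 := h.sqrtq_ne_zero
  have h2 : (Real.pi : ℂ) ≠ 0 := by exact_mod_cast Real.pi_ne_zero
  field_simp

theorem isPointForceDisplacement_uP1 (h : Admissible lam mu mus) (P : ℝ) :
    IsPointForceDisplacement lam mu mus ![P, 0] (realField (uP1 lam mu mus P)) := by
  choose w' hw using h.exists_isLogType_uP1 P
  refine isPointForceDisplacement_realField hw (fun k x hx => h.im_uP1 P k hx) fun ψ => ?_
  have h0 := pairing_eq_of_eq_lincomb (hw 0).locallyIntegrable (h.isLogType_log 0).locallyIntegrable
    (h.isLogType_log 1).locallyIntegrable _ _ (fun x hx => h.uP1_zero_eq P hx)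
  have h1 := pairing_eq_of_eq_const_mul (hw 1).locallyIntegrable
    h.isLogType_angle.locallyIntegrable _ (fun x _ => h.uP1_one_eq P x)
  have hn := h.normalization P
  have hA0 := h.Y1_mul 0
  have hA1 := h.Y1_mul 1
  have hs0 := h.Y1_mul_s 0
  have hs1 := h.Y1_mul_s 1
  have he0 := h.Y1_eq 0
  have he1 := h.Y1_eq 1
  set c := (P : ℂ) / (2 * Real.pi * sqrtq lam mu mus)
  constructor
  · have hmix : pairing _ (hw 1).locallyIntegrable (TestFun.d 0 (TestFun.d 1 ψ)) = _ := h1 _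
    -- this order of the derivatives expresses the mixed one through `∂₁²` alone
    rw [TestFun.d_comm 0 1, h.pairing_angle_d_one] at hmix
    rw [TestFun.d_comm 0 1, hmix, h0, h0, h.pairing_log_d, h.pairing_log_d]
    simp only [Matrix.cons_val_zero]
    set a0 := pairing _ (h.isLogType_log 0).locallyIntegrable (TestFun.d 0 (TestFun.d 0 ψ))
    set a1 := pairing _ (h.isLogType_log 1).locallyIntegrable (TestFun.d 0 (TestFun.d 0 ψ))
    linear_combination (c / 2 * a0) * hA0 - (c / 2 * a1) * hA1 + ψ.1 0 * hn
      + (2 * Real.pi * c * mus * ψ.1 0) * (hs0 - hs1)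
  · have h00 := h.pairing_angle_d_zero (TestFun.d 0 ψ)
    have h11 := h.pairing_angle_d_one (TestFun.d 1 ψ)
    rw [TestFun.d_comm 1 0] at h00
    rw [h1, h1, h0, h00, h11]
    simp only [Matrix.cons_val_one, Matrix.cons_val_zero, Complex.ofReal_zero, zero_mul]
    rw [he0, he1]
    ring

theorem isPointForceDisplacement_uP2 (h : Admissible lam mu mus) (P : ℝ) :
    IsPointForceDisplacement lam mu mus ![0, P] (realField (uP2 lam mu mus P)) := by
  choose w' hw using h.exists_isLogType_uP2 P
  refine isPointForceDisplacement_realField hw (fun k x hx => h.im_uP2 P k hx) fun ψ => ?_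
  have h1 := pairing_eq_of_eq_lincomb (hw 1).locallyIntegrable (h.isLogType_log 0).locallyIntegrable
    (h.isLogType_log 1).locallyIntegrable _ _ (fun x hx => h.uP2_one_eq P hx)
  have h0 := pairing_eq_of_eq_const_mul (hw 0).locallyIntegrable
    h.isLogType_angle.locallyIntegrable _ (fun x _ => h.uP2_zero_eq P x)
  have hn := h.normalization P
  have hA0 := h.Y2_mul 0
  have hA1 := h.Y2_mul 1
  have hs0 := h.Y2_mul_s 0
  have hs1 := h.Y2_mul_s 1
  have he0 := h.Y2_eq 0
  have he1 := h.Y2_eq 1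
  set c := (P : ℂ) / (2 * Real.pi * sqrtq lam mu mus)
  constructor
  · have h00 := h.pairing_angle_d_zero (TestFun.d 0 ψ)
    have h11 := h.pairing_angle_d_one (TestFun.d 1 ψ)
    rw [TestFun.d_comm 1 0] at h00
    rw [h0, h0, h1, h00, h11]
    simp only [Matrix.cons_val_zero, Complex.ofReal_zero, zero_mul]
    rw [he0, he1]
    ring
  · have hmix : pairing _ (hw 0).locallyIntegrable (TestFun.d 0 (TestFun.d 1 ψ)) = _ := h0 _
    -- this order of the derivatives expresses the mixed one through `∂₁²` alone
    rw [TestFun.d_comm 0 1, h.pairing_angle_d_one] at hmix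
    rw [TestFun.d_comm 0 1, hmix, h1, h1, h.pairing_log_d, h.pairing_log_d]
    simp only [Matrix.cons_val_one, Matrix.cons_val_zero]
    set a0 := pairing _ (h.isLogType_log 0).locallyIntegrable (TestFun.d 0 (TestFun.d 0 ψ))
    set a1 := pairing _ (h.isLogType_log 1).locallyIntegrable (TestFun.d 0 (TestFun.d 0 ψ))
    linear_combination (c / 2 * a0) * hA0 - (c / 2 * a1) * hA1 + ψ.1 0 * hn
      + (2 * Real.pi * c * (lam + 2 * mu) * ψ.1 0) * (hs0 - hs1)

end Admissible

/-! ### Combinations of displacement fields and rigid displacements -/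

theorem IsPointForceDisplacement.add_const_mul {lam mu mus : ℝ} {F G H : Fin 2 → ℝ}
    {u v w : Displacement} (hu : IsPointForceDisplacement lam mu mus F u)
    (hv : IsPointForceDisplacement lam mu mus G v) (c : ℝ)
    (hw : ∀ k x, x ≠ 0 → w k x = u k x + c * v k x) (hH : ∀ k, H k = F k + c * G k) :
    IsPointForceDisplacement lam mu mus H w := by
  have hloc : ∀ k, LocallyIntegrable (w k) := by
    intro k
    have h1 : LocallyIntegrable fun x => u k x + c * v k x :=
      (hu.locallyIntegrable k).add ((hv.locallyIntegrable k).smul c)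
    refine h1.congr ?_
    filter_upwards [ae_ne_zero] with x hx using (hw k x hx).symm
  refine ⟨hloc, fun k => ?_, (solvesEquilibrium_iff hloc).2 fun ψ => ?_, fun k l => ?_⟩
  · exact ((hu.contDiffOn k).add (contDiffOn_const.mul (hv.contDiffOn k))).congr
      fun x hx => hw k x hx
  · have h1 := (solvesEquilibrium_iff hu.locallyIntegrable).1 hu.equilibrium ψ
    have h2 := (solvesEquilibrium_iff hv.locallyIntegrable).1 hv.equilibrium ψ
    have hT : ∀ k (χ : TestFun), pairing _ (locallyIntegrable_ofReal (hloc k)) χ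
        = 1 * pairing _ (locallyIntegrable_ofReal (hu.locallyIntegrable k)) χ
          + c * pairing _ (locallyIntegrable_ofReal (hv.locallyIntegrable k)) χ := fun k =>
      pairing_eq_of_eq_lincomb _ _ _ _ _ fun x hx => by
        rw [hw k x hx]; push_cast; ring
    simp only [hT, hH]
    push_cast
    exact ⟨by linear_combination h1.1 + c * h2.1, by linear_combination h1.2 + c * h2.2⟩
  · have h0 : Tendsto (fun x => strain u k l x + c * strain v k l x) (cocompact (ℝ × ℝ)) (𝓝 0) := by
      simpa using (hu.strain_tendsto k l).add ((hv.strain_tendsto k l).const_mul c)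
    refine h0.congr' ?_
    have hne : ∀ᶠ x : ℝ × ℝ in cocompact (ℝ × ℝ), x ≠ 0 :=
      (isCompact_singleton (x := (0 : ℝ × ℝ))).compl_mem_cocompact
    have hpd : ∀ i j x, x ≠ 0 → pd i (w j) x = pd i (u j) x + c * pd i (v j) x := by
      intro i j x hx
      have hn : {0}ᶜ ∈ 𝓝 x := isOpen_compl_singleton.mem_nhds hx
      have hdu := (((hu.contDiffOn j).contDiffAt hn).differentiableAt (by simp)).hasFDerivAt
      have hdv := (((hv.contDiffOn j).contDiffAt hn).differentiableAt (by simp)).hasFDerivAt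
      have hdw : HasFDerivAt (w j) (fderiv ℝ (u j) x + c • fderiv ℝ (v j) x) x :=
        (hdu.add (hdv.const_mul c)).congr_of_eventuallyEq (by
          filter_upwards [hn] with y hy using hw j y hy)
      simp only [pd_eq, hdw.fderiv]
      simp
    filter_upwards [hne] with x hx
    simp only [strain, hpd _ _ x hx]
    ring

theorem hasFDerivAt_rigid (c : Fin 2 → ℝ) (rot : ℝ) (k : Fin 2) (x : ℝ × ℝ) :
    HasFDerivAt (rigid c rot k) ((![-rot • ContinuousLinearMap.snd ℝ ℝ ℝ,
      rot • ContinuousLinearMap.fst ℝ ℝ ℝ] : Fin 2 → (ℝ × ℝ →L[ℝ] ℝ)) k) x := by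
  fin_cases k
  · have h := (((ContinuousLinearMap.snd ℝ ℝ ℝ).hasFDerivAt (x := x)).const_mul
      (-rot)).const_add (c 0)
    refine h.congr_of_eventuallyEq (Eventually.of_forall fun y => ?_)
    simp [rigid, sub_eq_add_neg]
  · exact (((ContinuousLinearMap.fst ℝ ℝ ℝ).hasFDerivAt (x := x)).const_mul rot).const_add (c 1)

theorem contDiff_rigid (c : Fin 2 → ℝ) (rot : ℝ) (k : Fin 2) : ContDiff ℝ 1 (rigid c rot k) := by
  fin_cases k
  · exact contDiff_const.sub (contDiff_const.mul contDiff_snd)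
  · exact contDiff_const.add (contDiff_const.mul contDiff_fst)

theorem isPointForceDisplacement_rigid (lam mu mus : ℝ) (c : Fin 2 → ℝ) (rot : ℝ) :
    IsPointForceDisplacement lam mu mus 0 (rigid c rot) := by
  have hloc : ∀ k, LocallyIntegrable (rigid c rot k) := fun k =>
    (contDiff_rigid c rot k).continuous.locallyIntegrable
  refine ⟨hloc, fun k => (contDiff_rigid c rot k).contDiffOn,
    (solvesEquilibrium_iff hloc).2 fun ψ => ?_, fun k l => ?_⟩
  · have hT : ∀ k i j, pairing _ (locallyIntegrable_ofReal (hloc k))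
        (TestFun.d i (TestFun.d j ψ)) = 0 := by
      intro k i j
      have h0 : LocallyIntegrable fun _ : ℝ × ℝ => (0 : ℂ) := locallyIntegrable_const 0
      rw [pairing_d (f' := fun _ : ℝ × ℝ => ((fderiv ℝ (rigid c rot k) 0 (basisVec i) : ℝ) : ℂ)) _
        (locallyIntegrable_const _) (fun x _ => ?_), pairing_d _ h0 (fun x _ => ?_), pairing_apply]
      · simp
      · exact ⟨0, hasFDerivAt_const _ _, rfl⟩
      · refine ⟨_, Complex.ofRealCLM.hasFDerivAt.comp x (hasFDerivAt_rigid c rot k x), ?_⟩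
        rw [(hasFDerivAt_rigid c rot k 0).fderiv]
        rfl
    simp only [hT]
    simp
  · have : strain (rigid c rot) k l = fun _ => 0 := by
      ext x
      simp only [strain, pd_eq, (hasFDerivAt_rigid c rot _ x).fderiv]
      fin_cases k <;> fin_cases l <;> simp [basisVec]
    rw [this]
    exact tendsto_const_nhds

/-! ### Liouville theorems -/

theorem clm_ext_basisVec {L M : ℝ × ℝ →L[ℝ] ℂ} (h : ∀ i, L (basisVec i) = M (basisVec i)) :
    L = M := by
  have h0 := h 0
  have h1 := h 1
  simp only [basisVec, if_true, one_ne_zero, if_false] at h0 h1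
  ext <;> simp [h0, h1]

theorem eq_affine_of_hasFDerivAt {f : ℝ × ℝ → ℂ} {c : Fin 2 → ℂ}
    (h : ∀ x, ∃ L : ℝ × ℝ →L[ℝ] ℂ, HasFDerivAt f L x ∧ ∀ i, L (basisVec i) = c i) (x : ℝ × ℝ) :
    f x = f 0 + c 0 * x.1 + c 1 * x.2 := by
  have hd : ∀ y : ℝ × ℝ, HasFDerivAt (fun y : ℝ × ℝ => f y - (c 0 * coord 0 y + c 1 * coord 1 y))
      (0 : ℝ × ℝ →L[ℝ] ℂ) y := by
    intro y
    obtain ⟨L, hL, hi⟩ := h y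
    refine (hL.sub (((coord 0).hasFDerivAt (x := y)).const_mul (c 0) |>.add
      (((coord 1).hasFDerivAt (x := y)).const_mul (c 1)))).congr_fderiv
        (clm_ext_basisVec fun i => ?_)
    simp only [sub_apply, add_apply, smul_apply, hi, zero_apply]
    fin_cases i <;> simp [basisVec, coord_zero_apply, coord_one_apply]
  have := is_const_of_fderiv_eq_zero (𝕜 := ℝ) (fun y => (hd y).differentiableAt)
    (fun y => (hd y).fderiv) x 0
  simp only [coord_zero_apply, coord_one_apply, Prod.fst_zero, Prod.snd_zero] at this
  push_cast at this
  linear_combination this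

/-- After the real-linear change of variables `z = x₁ + i σ x₂` the equation `∂₂ f = i σ ∂₁ f` is
the Cauchy-Riemann equation, and Liouville's theorem applies. -/
theorem eq_zero_of_first_order {f : ℝ × ℝ → ℂ} {σ : ℂ} (hσ : σ.re ≠ 0)
    (hf : ∀ x, ∃ L : ℝ × ℝ →L[ℝ] ℂ, HasFDerivAt f L x ∧
      L (basisVec 1) = σ * Complex.I * L (basisVec 0))
    (hlim : Tendsto f (cocompact (ℝ × ℝ)) (𝓝 0)) : f = 0 := by
  -- the inverse of `linForm σ`
  set N : ℂ →L[ℝ] ℝ × ℝ := (Complex.reCLM + (σ.im / σ.re) • Complex.imCLM).prod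
    ((σ.re)⁻¹ • Complex.imCLM) with hN
  have hN1 : ∀ z, (N z).1 = z.re + σ.im / σ.re * z.im := fun z => rfl
  have hN2 : ∀ z, (N z).2 = (σ.re)⁻¹ * z.im := fun z => rfl
  have hTN : ∀ z, linForm σ (N z) = z := by
    intro z
    apply Complex.ext
    · rw [linForm_re, hN1, hN2]; field_simp; ring
    · rw [linForm_im, hN2]; field_simp
  have hNT : ∀ x, N (linForm σ x) = x := by
    intro x
    apply Prod.ext
    · rw [hN1, linForm_re, linForm_im]; field_simp; ring
    · rw [hN2, linForm_im]; field_simp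
  have hdiff : Differentiable ℂ (f ∘ N) := by
    intro z
    obtain ⟨L, hL, hrel⟩ := hf (N z)
    have h1 := hL.comp z N.hasFDerivAt
    have hdir : ∀ w, fderiv ℝ (f ∘ N) z w = L (basisVec 0) * w := by
      intro w
      rw [h1.fderiv]
      have hdec : N w = (N w).1 • basisVec 0 + (N w).2 • basisVec 1 := by
        ext <;> simp [basisVec]
      have hw := hTN w
      change L (N w) = _
      rw [hdec, map_add, map_smul, map_smul, hrel, Complex.real_smul, Complex.real_smul]
      conv_rhs => rw [← hw]
      simp only [linForm]
      ring
    rw [differentiableAt_complex_iff_differentiableAt_real]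
    refine ⟨h1.differentiableAt, ?_⟩
    rw [hdir, hdir, smul_eq_mul]
    ring
  have hcoc : Tendsto N (cocompact ℂ) (cocompact (ℝ × ℝ)) := by
    refine Tendsto.mono_right (tendsto_comap_iff.2 ?_)
      (comap_cocompact_le (contDiff_linForm σ (n := 0)).continuous)
    have : linForm σ ∘ N = id := funext hTN
    rw [this]
    exact tendsto_id
  ext x
  have := hdiff.apply_eq_of_tendsto_cocompact (linForm σ x) (hlim.comp hcoc)
  rw [Function.comp_apply, hNT] at this
  exact this

/-- The operator `∂₂ - i σ ∂₁` on test functions. -/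
noncomputable def TestFun.cr (σ : ℂ) (ψ : TestFun) : TestFun :=
  TestFun.d 1 ψ - (σ * Complex.I) • TestFun.d 0 ψ

/-- A family of functions indexed by test functions that commutes with derivatives and vanishes at
infinity. -/
structure IsDecayingFamily (E : TestFun →ₗ[ℂ] (ℝ × ℝ → ℂ)) : Prop where
  hasFDerivAt : ∀ ψ x, ∃ L : ℝ × ℝ →L[ℝ] ℂ, HasFDerivAt (E ψ) L x ∧
    ∀ i, L (basisVec i) = E (TestFun.d i ψ) x
  tendsto : ∀ ψ, Tendsto (E ψ) (cocompact (ℝ × ℝ)) (𝓝 0)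

theorem IsDecayingFamily.eq_zero_of_cr {E : TestFun →ₗ[ℂ] (ℝ × ℝ → ℂ)} (hE : IsDecayingFamily E)
    {σ : ℂ} (hσ : σ.re ≠ 0) {ψ : TestFun} (h : E (TestFun.cr σ ψ) = 0) : E ψ = 0 := by
  refine eq_zero_of_first_order hσ (fun x => ?_) (hE.tendsto ψ)
  obtain ⟨L, hL, hi⟩ := hE.hasFDerivAt ψ x
  refine ⟨L, hL, ?_⟩
  have hx := congrFun h x
  simp only [TestFun.cr, map_sub, map_smul] at hx
  rw [hi, hi]
  exact sub_eq_zero.1 hx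

/-- Liouville's theorem for a product of two elliptic operators `∂₂² + s² ∂₁²`, by factoring it into
four operators of first order. -/
theorem IsDecayingFamily.eq_zero {E : TestFun →ₗ[ℂ] (ℝ × ℝ → ℂ)} (hE : IsDecayingFamily E)
    {s t : ℂ} (hs : s.re ≠ 0) (ht : t.re ≠ 0)
    (h : ∀ ψ, E (TestFun.d 1 (TestFun.d 1 (TestFun.d 1 (TestFun.d 1 ψ)))
      + (s ^ 2 + t ^ 2) • TestFun.d 0 (TestFun.d 0 (TestFun.d 1 (TestFun.d 1 ψ)))
      + (s ^ 2 * t ^ 2) • TestFun.d 0 (TestFun.d 0 (TestFun.d 0 (TestFun.d 0 ψ)))) = 0)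
    (ψ : TestFun) : E ψ = 0 := by
  have hc : ∀ χ, TestFun.d 1 (TestFun.d 0 χ) = TestFun.d 0 (TestFun.d 1 χ) := TestFun.d_comm 1 0
  have hsq : ∀ (z : ℂ) (χ : TestFun), TestFun.cr z (TestFun.cr (-z) χ)
      = TestFun.d 1 (TestFun.d 1 χ) + z ^ 2 • TestFun.d 0 (TestFun.d 0 χ) := by
    intro z χ
    simp only [TestFun.cr, map_sub, map_smul, hc]
    match_scalars
    · ring
    · ring
    · linear_combination (-z ^ 2) * Complex.I_sq
  have hs' : (-s).re ≠ 0 := by simpa using hs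
  have ht' : (-t).re ≠ 0 := by simpa using ht
  refine hE.eq_zero_of_cr ht' (hE.eq_zero_of_cr ht (hE.eq_zero_of_cr hs' (hE.eq_zero_of_cr hs ?_)))
  rw [← h ψ, hsq, hsq]
  congr 1
  simp only [map_add, map_smul, hc]
  module

/-! ### Mollification of displacement fields -/

/-- The convolution of `f` with test functions. -/
noncomputable def mollify (f : ℝ × ℝ → ℂ) (hf : LocallyIntegrable f) :
    TestFun →ₗ[ℂ] (ℝ × ℝ → ℂ) where
  toFun ψ x := pairing f hf (TestFun.refl x ψ)
  map_add' ψ χ := by ext x; simp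
  map_smul' c ψ := by ext x; simp

theorem mollify_apply {f : ℝ × ℝ → ℂ} (hf : LocallyIntegrable f) (ψ : TestFun) (x : ℝ × ℝ) :
    mollify f hf ψ x = pairing f hf (TestFun.refl x ψ) := rfl

theorem hasFDerivAt_mollify {f : ℝ × ℝ → ℂ} (hf : LocallyIntegrable f) (ψ : TestFun) (x : ℝ × ℝ) :
    ∃ L : ℝ × ℝ →L[ℝ] ℂ, HasFDerivAt (mollify f hf ψ) L x ∧
      ∀ i, L (basisVec i) = mollify f hf (TestFun.d i ψ) x := by
  refine ⟨_, ψ.hasCompactSupport.hasFDerivAt_convolution_right (ContinuousLinearMap.mul ℝ ℂ) hf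
    (ψ.contDiff.of_le (by simp)) x, fun i => ?_⟩
  rw [convolution_precompR_apply _ hf (ψ.hasCompactSupport.fderiv (𝕜 := ℝ))
    (ψ.contDiff.continuous_fderiv (by simp))]
  rfl

theorem d_refl_d (i j : Fin 2) (x : ℝ × ℝ) (ψ : TestFun) :
    TestFun.d i (TestFun.d j (TestFun.refl x ψ))
      = TestFun.refl x (TestFun.d i (TestFun.d j ψ)) := by
  rw [TestFun.d_refl, map_neg, TestFun.d_refl, neg_neg]

/-- Convolutions with shrinking bumps converge at every point of continuity. -/
theorem tendsto_mollify {f : ℝ × ℝ → ℂ} (hf : LocallyIntegrable f)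
    {φ : ℕ → ContDiffBump (0 : ℝ × ℝ)}
    (hφ : Tendsto (fun n => (φ n).rOut) atTop (𝓝 0)) {x : ℝ × ℝ} (hx : ContinuousAt f x) :
    Tendsto (fun n => mollify f hf (TestFun.ofReal ((φ n).normed volume) (φ n).contDiff_normed
      (φ n).hasCompactSupport_normed) x) atTop (𝓝 (f x)) := by
  have h := ContDiffBump.convolution_tendsto_right (μ := volume) (φ := φ) (g := fun _ => f)
    (k := fun _ => x) hφ (Eventually.of_forall fun _ => hf.aestronglyMeasurable)
    (hx.tendsto.comp tendsto_snd) tendsto_const_nhds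
  refine h.congr fun n => ?_
  rw [convolution_eq_swap, mollify_apply, pairing_apply]
  refine integral_congr_ae (Eventually.of_forall fun y => ?_)
  simp [TestFun.refl, TestFun.ofReal, mul_comm]

/-! ### Uniqueness up to rigid displacements -/

/-- Far from the origin the translated test function does not see the singularity of `w`, so that
a derivative may be moved from it to `w`. -/
theorem pairing_refl_d {w : ℝ × ℝ → ℝ} (hw : LocallyIntegrable w) (hd : ContDiffOn ℝ 1 w {0}ᶜ)
    (ψ : TestFun) {R : ℝ} (hR : ∀ x : ℝ × ℝ, R < ‖x‖ → ψ.1 x = 0) (i : Fin 2) {x : ℝ × ℝ}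
    (hx : R < ‖x‖) :
    Integrable (fun y => (pd i w y : ℂ) * ψ.1 (x - y)) ∧
      pairing _ (locallyIntegrable_ofReal hw) (TestFun.refl x (TestFun.d i ψ))
        = ∫ y, (pd i w y : ℂ) * ψ.1 (x - y) := by
  have hint : Integrable (fun y => (pd i w y : ℂ) * ψ.1 (x - y)) := by
    refine Continuous.integrable_of_hasCompactSupport ?_
      ((TestFun.refl x ψ).hasCompactSupport.mul_left)
    refine continuous_iff_continuousAt.2 fun y => ?_
    by_cases hy : y = 0
    -- near the origin the second factor vanishes, as `x` is far away
    · have hev : (fun y => (pd i w y : ℂ) * ψ.1 (x - y)) =ᶠ[𝓝 y] fun _ => 0 := by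
        have hopen : ∀ᶠ z in 𝓝 y, R < ‖x - z‖ := by
          refine (continuous_const.sub continuous_id).norm.continuousAt.eventually_const_lt ?_
          simpa [hy] using hx
        filter_upwards [hopen] with z hz
        rw [hR _ hz, mul_zero]
      exact continuousAt_const.congr hev.symm
    · have hcont : ContinuousOn (pd i w) {0}ᶜ :=
        (hd.continuousOn_fderiv_of_isOpen isOpen_compl_singleton le_rfl).clm_apply
          continuousOn_const
      have h1 := hcont.continuousAt (isOpen_compl_singleton.mem_nhds hy)
      exact (Complex.continuous_ofReal.continuousAt.comp h1).mul
        (TestFun.refl x ψ).continuous.continuousAt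
  refine ⟨hint, ?_⟩
  have hdw : ∀ y ≠ 0, HasFDerivAt (fun y => (w y : ℂ)) (Complex.ofRealCLM.comp (fderiv ℝ w y)) y :=
    fun y hy => Complex.ofRealCLM.hasFDerivAt.comp y
      ((hd.contDiffAt (isOpen_compl_singleton.mem_nhds hy)).differentiableAt (by simp)).hasFDerivAt
  have hg : ∀ y ≠ 0, HasFDerivAt (fun y => (w y : ℂ) * (TestFun.refl x ψ).1 y)
      ((w y : ℂ) • fderiv ℝ (TestFun.refl x ψ).1 y
        + (TestFun.refl x ψ).1 y • Complex.ofRealCLM.comp (fderiv ℝ w y)) y :=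
    fun y hy => (hdw y hy).mul ((TestFun.refl x ψ).differentiable y).hasFDerivAt
  have hpt : (fun y => ((w y : ℂ) • fderiv ℝ (TestFun.refl x ψ).1 y
        + (TestFun.refl x ψ).1 y • Complex.ofRealCLM.comp (fderiv ℝ w y)) (basisVec i))
      = fun y => (pd i w y : ℂ) * ψ.1 (x - y)
        - (w y : ℂ) * (TestFun.refl x (TestFun.d i ψ)).1 y := by
    ext y
    have h1 : fderiv ℝ (TestFun.refl x ψ).1 y (basisVec i)
        = -(TestFun.refl x (TestFun.d i ψ)).1 y := by
      rw [← TestFun.d_apply, TestFun.d_refl]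
      rfl
    simp only [add_apply, smul_apply, h1, smul_eq_mul, ContinuousLinearMap.comp_apply,
      Complex.ofRealCLM_apply, TestFun.refl_apply, pd_eq]
    ring
  have hi2 := integrable_mul_testFun (locallyIntegrable_ofReal hw) (TestFun.refl x (TestFun.d i ψ))
  have h0 := integral_partial_eq_zero i hg ((TestFun.refl x ψ).hasCompactSupport.mul_left)
    (by rw [hpt]; exact hint.sub hi2)
  rw [hpt, integral_sub hint hi2] at h0
  exact (sub_eq_zero.1 h0).symm

/-- The mollified components of a displacement field. -/
noncomputable def mollifyReal {u : Displacement} (hu : ∀ k, LocallyIntegrable (u k)) (k : Fin 2) :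
    TestFun →ₗ[ℂ] (ℝ × ℝ → ℂ) :=
  mollify _ (locallyIntegrable_ofReal (hu k))

/-- Twice the strain of the mollified field. -/
noncomputable def mollifyStrain {u : Displacement} (hu : ∀ k, LocallyIntegrable (u k))
    (k l : Fin 2) : TestFun →ₗ[ℂ] (ℝ × ℝ → ℂ) :=
  (mollifyReal hu k).comp (TestFun.d l) + (mollifyReal hu l).comp (TestFun.d k)

theorem mollifyStrain_apply {u : Displacement} (hu : ∀ k, LocallyIntegrable (u k)) (k l : Fin 2)
    (ψ : TestFun) (x : ℝ × ℝ) : mollifyStrain hu k l ψ x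
      = mollifyReal hu k (TestFun.d l ψ) x + mollifyReal hu l (TestFun.d k ψ) x := rfl

namespace IsPointForceDisplacement

variable {lam mu mus : ℝ} {F : Fin 2 → ℝ} {u : Displacement}

/-- At a point far away the mollified strain is an average of nearby values of the strain. -/
theorem tendsto_mollifyStrain (hu : IsPointForceDisplacement lam mu mus F u) (k l : Fin 2)
    (ψ : TestFun) :
    Tendsto (mollifyStrain hu.locallyIntegrable k l ψ) (cocompact (ℝ × ℝ)) (𝓝 0) := by
  obtain ⟨R, hR0, hR⟩ := exists_radius ψ
  set I : ℝ := ∫ y, ‖ψ.1 y‖ with hI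
  have hI0 : 0 ≤ I := integral_nonneg fun _ => norm_nonneg _
  have hψi : Integrable fun y => ‖ψ.1 y‖ :=
    (ψ.continuous.integrable_of_hasCompactSupport ψ.hasCompactSupport).norm
  rw [Metric.tendsto_nhds]
  intro ε hε
  set δ : ℝ := ε / (2 * (I + 1)) with hδ
  have hδ0 : 0 < δ := by positivity
  have hstr := Metric.tendsto_nhds.1 (hu.strain_tendsto k l) δ hδ0
  obtain ⟨K, hK, hKs⟩ := mem_cocompact.1 hstr
  obtain ⟨M, hM⟩ := hK.isBounded.subset_closedBall 0
  filter_upwards [(tendsto_norm_cocompact_atTop (E := ℝ × ℝ)).eventually_gt_atTop (R + max M 0)]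
    with x hx
  have hxR : R < ‖x‖ := by linarith [le_max_right M 0]
  obtain ⟨hi1, he1⟩ := pairing_refl_d (hu.locallyIntegrable k) (hu.contDiffOn k) ψ hR l hxR
  obtain ⟨hi2, he2⟩ := pairing_refl_d (hu.locallyIntegrable l) (hu.contDiffOn l) ψ hR k hxR
  have hval : mollifyStrain hu.locallyIntegrable k l ψ x
      = ∫ y, (2 * strain u k l y : ℂ) * ψ.1 (x - y) := by
    rw [mollifyStrain_apply, mollifyReal, mollifyReal, mollify_apply, mollify_apply, he1, he2,
      ← integral_add hi1 hi2]
    refine integral_congr_ae (Eventually.of_forall fun y => ?_)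
    simp only [strain]
    push_cast
    ring
  have hbound : ‖∫ y, (2 * strain u k l y : ℂ) * ψ.1 (x - y)‖ ≤ ∫ y, 2 * δ * ‖ψ.1 (x - y)‖ := by
    refine norm_integral_le_of_norm_le ((hψi.comp_sub_left x).const_mul (2 * δ))
      (Eventually.of_forall fun y => ?_)
    by_cases hy : R < ‖x - y‖
    · simp [hR _ hy]
    · have hyM : M < ‖y‖ := by
        have := norm_sub_norm_le x y
        linarith [le_max_left M 0, not_lt.1 hy]
      have hs : dist (strain u k l y) 0 < δ := hKs fun hyK => by
        have := hM hyK
        rw [mem_closedBall_zero_iff] at this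
        linarith
      rw [dist_zero_right] at hs
      rw [norm_mul, norm_mul, Complex.norm_ofNat, Complex.norm_real]
      gcongr
  rw [dist_zero_right, hval]
  refine hbound.trans_lt ?_
  rw [integral_const_mul, integral_sub_left_eq_self (fun y => ‖ψ.1 y‖), ← hI, hδ]
  have h1 : 2 * (ε / (2 * (I + 1))) * I = ε * (I / (I + 1)) := by field_simp
  have h2 : I / (I + 1) < 1 := by rw [div_lt_one (by positivity)]; linarith
  rw [h1]
  nlinarith

theorem isDecayingFamily_mollifyStrain (hu : IsPointForceDisplacement lam mu mus F u)
    (k l : Fin 2) : IsDecayingFamily (mollifyStrain hu.locallyIntegrable k l) where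
  tendsto := hu.tendsto_mollifyStrain k l
  hasFDerivAt ψ x := by
    obtain ⟨L, hL, hi⟩ :=
      hasFDerivAt_mollify (locallyIntegrable_ofReal (hu.locallyIntegrable k)) (TestFun.d l ψ) x
    obtain ⟨M, hM, hj⟩ :=
      hasFDerivAt_mollify (locallyIntegrable_ofReal (hu.locallyIntegrable l)) (TestFun.d k ψ) x
    refine ⟨L + M, hL.add hM, fun i => ?_⟩
    rw [add_apply, hi, hj, TestFun.d_comm i l, TestFun.d_comm i k]
    rfl

/-- Each component of the mollified field satisfies the scalar equation that belongs to the
determinant of the symbol; it follows from the equilibrium equations by multiplication with the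
adjugate matrix. -/
theorem mollifyReal_quartic (hu : IsPointForceDisplacement lam mu mus 0 u)
    (h : Admissible lam mu mus) (k : Fin 2) (ψ : TestFun) :
    mollifyReal hu.locallyIntegrable k (TestFun.d 1 (TestFun.d 1 (TestFun.d 1 (TestFun.d 1 ψ)))
      + (s lam mu mus 0 ^ 2 + s lam mu mus 1 ^ 2) •
        TestFun.d 0 (TestFun.d 0 (TestFun.d 1 (TestFun.d 1 ψ)))
      + (s lam mu mus 0 ^ 2 * s lam mu mus 1 ^ 2) •
        TestFun.d 0 (TestFun.d 0 (TestFun.d 0 (TestFun.d 0 ψ)))) = 0 := by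
  have heq : ∀ χ : TestFun, ∀ x,
      (lam + 2 * mu) * mollifyReal hu.locallyIntegrable 0 (TestFun.d 0 (TestFun.d 0 χ)) x
        + mus * mollifyReal hu.locallyIntegrable 0 (TestFun.d 1 (TestFun.d 1 χ)) x
        + (lam + mus) * mollifyReal hu.locallyIntegrable 1 (TestFun.d 0 (TestFun.d 1 χ)) x = 0 ∧
      (lam + 2 * mu) * mollifyReal hu.locallyIntegrable 1 (TestFun.d 1 (TestFun.d 1 χ)) x
        + mus * mollifyReal hu.locallyIntegrable 1 (TestFun.d 0 (TestFun.d 0 χ)) x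
        + (lam + mus) * mollifyReal hu.locallyIntegrable 0 (TestFun.d 0 (TestFun.d 1 χ)) x = 0 := by
    intro χ x
    have := (solvesEquilibrium_iff hu.locallyIntegrable).1 hu.equilibrium (TestFun.refl x χ)
    simp only [d_refl_d, Pi.zero_apply, Complex.ofReal_zero, zero_mul, add_zero] at this
    exact this
  have hc : ∀ χ, TestFun.d 1 (TestFun.d 0 χ) = TestFun.d 0 (TestFun.d 1 χ) := TestFun.d_comm 1 0
  have hAB : (mus * (lam + 2 * mu) : ℂ) ≠ 0 := by
    exact_mod_cast (mul_pos h.mus_pos h.lam_two_mu_pos).ne'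
  have hsum := h.s_sq_add
  rw [Admissible.p_eq_complex, neg_neg] at hsum
  ext x
  refine mul_left_cancel₀ hAB ?_
  rw [h.s_sq_mul]
  -- the equilibrium equations, tested with the derivatives of `ψ` that form the adjugate matrix
  have e1 := heq ((mus : ℂ) • TestFun.d 0 (TestFun.d 0 ψ)
    + (lam + 2 * mu : ℂ) • TestFun.d 1 (TestFun.d 1 ψ)) x
  have e2 := heq ((lam + 2 * mu : ℂ) • TestFun.d 0 (TestFun.d 0 ψ)
    + (mus : ℂ) • TestFun.d 1 (TestFun.d 1 ψ)) x
  have e3 := heq (TestFun.d 0 (TestFun.d 1 ψ)) x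
  simp only [map_add, map_smul, hc, Pi.add_apply, Pi.smul_apply, smul_eq_mul] at e1 e2 e3
  fin_cases k
  · simp only [Fin.zero_eta, map_add, map_smul, Pi.add_apply, Pi.smul_apply, smul_eq_mul,
      Pi.zero_apply]
    linear_combination e1.1 - (lam + mus) * e3.2 + hsum *
      mollifyReal hu.locallyIntegrable 0 (TestFun.d 0 (TestFun.d 0 (TestFun.d 1 (TestFun.d 1 ψ)))) x
  · simp only [Fin.mk_one, map_add, map_smul, Pi.add_apply, Pi.smul_apply, smul_eq_mul,
      Pi.zero_apply]
    linear_combination e2.2 - (lam + mus) * e3.1 + hsum *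
      mollifyReal hu.locallyIntegrable 1 (TestFun.d 0 (TestFun.d 0 (TestFun.d 1 (TestFun.d 1 ψ)))) x

theorem mollifyStrain_eq_zero (hu : IsPointForceDisplacement lam mu mus 0 u)
    (h : Admissible lam mu mus) (k l : Fin 2) (ψ : TestFun) :
    mollifyStrain hu.locallyIntegrable k l ψ = 0 := by
  refine (hu.isDecayingFamily_mollifyStrain k l).eq_zero (h.s_re_pos 0).ne' (h.s_re_pos 1).ne'
    (fun χ => ?_) ψ
  have key : ∀ i j, mollifyReal hu.locallyIntegrable i (TestFun.d j
      (TestFun.d 1 (TestFun.d 1 (TestFun.d 1 (TestFun.d 1 χ)))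
      + (s lam mu mus 0 ^ 2 + s lam mu mus 1 ^ 2) •
        TestFun.d 0 (TestFun.d 0 (TestFun.d 1 (TestFun.d 1 χ)))
      + (s lam mu mus 0 ^ 2 * s lam mu mus 1 ^ 2) •
        TestFun.d 0 (TestFun.d 0 (TestFun.d 0 (TestFun.d 0 χ))))) = 0 := by
    intro i j
    rw [← hu.mollifyReal_quartic h i (TestFun.d j χ)]
    have h0 : ∀ η, TestFun.d j (TestFun.d 0 η) = TestFun.d 0 (TestFun.d j η) := TestFun.d_comm j 0
    have h1 : ∀ η, TestFun.d j (TestFun.d 1 η) = TestFun.d 1 (TestFun.d j η) := TestFun.d_comm j 1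
    congr 1
    simp only [map_add, map_smul, h0, h1]
  rw [mollifyStrain, LinearMap.add_apply, LinearMap.comp_apply, LinearMap.comp_apply, key, key,
    add_zero]

/-- A mollified field without strain is rigid. Its second derivatives `∂ₗ ∂ₘ uₖ` are symmetric in
`l`, `m` and antisymmetric in `k`, `l`, hence zero. -/
theorem mollifyReal_affine (hu : IsPointForceDisplacement lam mu mus 0 u)
    (h : Admissible lam mu mus) (k : Fin 2) (ψ : TestFun) (x : ℝ × ℝ) :
    mollifyReal hu.locallyIntegrable k ψ x = mollifyReal hu.locallyIntegrable k ψ 0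
      + mollifyReal hu.locallyIntegrable k (TestFun.d 0 ψ) 0 * x.1
      + mollifyReal hu.locallyIntegrable k (TestFun.d 1 ψ) 0 * x.2 := by
  set S := mollifyReal hu.locallyIntegrable with hS
  have hanti : ∀ k l χ y, S k (TestFun.d l χ) y = -S l (TestFun.d k χ) y := by
    intro k l χ y
    have := congrFun (hu.mollifyStrain_eq_zero h k l χ) y
    rw [mollifyStrain_apply] at this
    exact eq_neg_of_add_eq_zero_left this
  have hsecond : ∀ k l m χ y, S k (TestFun.d l (TestFun.d m χ)) y = 0 := by
    intro k l m χ y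
    have : S k (TestFun.d l (TestFun.d m χ)) y = -S k (TestFun.d l (TestFun.d m χ)) y := by
      calc S k (TestFun.d l (TestFun.d m χ)) y
          = -S l (TestFun.d k (TestFun.d m χ)) y := hanti _ _ _ _
        _ = -S l (TestFun.d m (TestFun.d k χ)) y := by rw [TestFun.d_comm]
        _ = S m (TestFun.d l (TestFun.d k χ)) y := by rw [hanti l m, neg_neg]
        _ = S m (TestFun.d k (TestFun.d l χ)) y := by rw [TestFun.d_comm]
        _ = -S k (TestFun.d m (TestFun.d l χ)) y := hanti _ _ _ _
        _ = -S k (TestFun.d l (TestFun.d m χ)) y := by rw [TestFun.d_comm]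
    exact self_eq_neg.1 this
  have hder : ∀ χ y, ∃ L : ℝ × ℝ →L[ℝ] ℂ, HasFDerivAt (S k χ) L y ∧
      ∀ i, L (basisVec i) = S k (TestFun.d i χ) y :=
    hasFDerivAt_mollify (locallyIntegrable_ofReal (hu.locallyIntegrable k))
  have hconst : ∀ i y, S k (TestFun.d i ψ) y = S k (TestFun.d i ψ) 0 := by
    intro i y
    have := eq_affine_of_hasFDerivAt (f := S k (TestFun.d i ψ)) (c := 0) (fun z => by
      obtain ⟨L, hL, hi⟩ := hder (TestFun.d i ψ) z
      exact ⟨L, hL, fun j => by rw [hi, hsecond]; rfl⟩) y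
    simpa using this
  exact eq_affine_of_hasFDerivAt (c := fun i => S k (TestFun.d i ψ) 0) (fun z => by
    obtain ⟨L, hL, hi⟩ := hder ψ z
    exact ⟨L, hL, fun j => by rw [hi, hconst]⟩) x

/-- Without a force only rigid displacements remain: the mollified fields are rigid, and a rigid
field is recovered linearly from its values at the points `(1, 0)` and `(2, 0)`. -/
theorem eq_rigid (hu : IsPointForceDisplacement lam mu mus 0 u) (h : Admissible lam mu mus) :
    ∃ (c : Fin 2 → ℝ) (rot : ℝ), ∀ k x, x ≠ 0 → u k x = rigid c rot k x := by
  have hrel : ∀ ψ x,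
      mollifyReal hu.locallyIntegrable 0 ψ x = mollifyReal hu.locallyIntegrable 0 ψ (1, 0)
        - (mollifyReal hu.locallyIntegrable 1 ψ (2, 0)
          - mollifyReal hu.locallyIntegrable 1 ψ (1, 0)) * x.2 ∧
      mollifyReal hu.locallyIntegrable 1 ψ x
        = (2 * mollifyReal hu.locallyIntegrable 1 ψ (1, 0)
          - mollifyReal hu.locallyIntegrable 1 ψ (2, 0))
        + (mollifyReal hu.locallyIntegrable 1 ψ (2, 0)
          - mollifyReal hu.locallyIntegrable 1 ψ (1, 0)) * x.1 := by
    intro ψ x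
    have hstrain : ∀ k l, mollifyReal hu.locallyIntegrable k (TestFun.d l ψ) 0
        + mollifyReal hu.locallyIntegrable l (TestFun.d k ψ) 0 = 0 := fun k l =>
      congrFun (hu.mollifyStrain_eq_zero h k l ψ) 0
    have h00 : mollifyReal hu.locallyIntegrable 0 (TestFun.d 0 ψ) 0 = 0 := by
      linear_combination hstrain 0 0 / 2
    have h11 : mollifyReal hu.locallyIntegrable 1 (TestFun.d 1 ψ) 0 = 0 := by
      linear_combination hstrain 1 1 / 2
    have h01 : mollifyReal hu.locallyIntegrable 0 (TestFun.d 1 ψ) 0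
        = -mollifyReal hu.locallyIntegrable 1 (TestFun.d 0 ψ) 0 := by
      linear_combination hstrain 0 1
    rw [hu.mollifyReal_affine h 0 ψ x, hu.mollifyReal_affine h 1 ψ x,
      hu.mollifyReal_affine h 0 ψ (1, 0), hu.mollifyReal_affine h 1 ψ (1, 0),
      hu.mollifyReal_affine h 1 ψ (2, 0), h00, h11, h01]
    push_cast
    constructor <;> ring
  set φ : ℕ → ContDiffBump (0 : ℝ × ℝ) := fun n =>
    { rIn := 1 / ((n : ℝ) + 1), rOut := 2 * (1 / ((n : ℝ) + 1)), rIn_pos := by positivity,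
      rIn_lt_rOut := by
        have : 0 < 1 / ((n : ℝ) + 1) := by positivity
        linarith } with hφ
  have hφ0 : Tendsto (fun n => (φ n).rOut) atTop (𝓝 0) := by
    have := (tendsto_one_div_add_atTop_nhds_zero_nat (𝕜 := ℝ)).const_mul 2
    rw [mul_zero] at this
    exact this
  set ψ : ℕ → TestFun := fun n => TestFun.ofReal ((φ n).normed volume) (φ n).contDiff_normed
    (φ n).hasCompactSupport_normed
  have hlim : ∀ k (x : ℝ × ℝ), x ≠ 0 →
      Tendsto (fun n => mollifyReal hu.locallyIntegrable k (ψ n) x) atTop (𝓝 (u k x : ℂ)) := by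
    intro k x hx
    refine tendsto_mollify (locallyIntegrable_ofReal (hu.locallyIntegrable k)) hφ0 ?_
    exact Complex.continuous_ofReal.continuousAt.comp
      ((hu.contDiffOn k).continuousOn.continuousAt (isOpen_compl_singleton.mem_nhds hx))
  have h1 : ((1, 0) : ℝ × ℝ) ≠ 0 := fun h => one_ne_zero (congrArg Prod.fst h)
  have h2 : ((2, 0) : ℝ × ℝ) ≠ 0 := fun h => two_ne_zero (congrArg Prod.fst h)
  have hrot := (hlim 1 _ h2).sub (hlim 1 _ h1)
  refine ⟨![u 0 (1, 0), 2 * u 1 (1, 0) - u 1 (2, 0)], u 1 (2, 0) - u 1 (1, 0), fun k x hx => ?_⟩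
  fin_cases k
  · have hr := (hlim 0 _ h1).sub (hrot.mul_const (x.2 : ℂ))
    have := tendsto_nhds_unique ((hlim 0 x hx).congr fun n => (hrel (ψ n) x).1) hr
    simp only [Fin.zero_eta, rigid, Matrix.cons_val_zero]
    exact_mod_cast this
  · have hr := (((hlim 1 _ h1).const_mul 2).sub (hlim 1 _ h2)).add (hrot.mul_const (x.1 : ℂ))
    have := tendsto_nhds_unique ((hlim 1 x hx).congr fun n => (hrel (ψ n) x).2) hr
    simp only [Fin.mk_one, rigid, Matrix.cons_val_one, Matrix.cons_val_zero]
    exact_mod_cast this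

/-- The displacement fields under a given force are the translates of any one of them by rigid
displacements. -/
theorem iff_eq_add_rigid (hu : IsPointForceDisplacement lam mu mus F u)
    (h : Admissible lam mu mus) (v : Displacement) :
    IsPointForceDisplacement lam mu mus F v ↔
      ∃ (c : Fin 2 → ℝ) (rot : ℝ), ∀ k x, x ≠ 0 → v k x = u k x + rigid c rot k x := by
  constructor
  · intro hv
    have hd : IsPointForceDisplacement lam mu mus 0 fun k x => v k x - u k x :=
      hv.add_const_mul hu (-1) (fun k x _ => by ring) (fun k => by simp)
    obtain ⟨c, rot, hc⟩ := hd.eq_rigid h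
    exact ⟨c, rot, fun k x hx => by linarith [hc k x hx]⟩
  · rintro ⟨c, rot, hc⟩
    exact hu.add_const_mul (isPointForceDisplacement_rigid lam mu mus c rot) 1
      (fun k x hx => by rw [hc k x hx, one_mul]) (fun k => by simp)

end IsPointForceDisplacement

end CubicGreen

theorem mainTheorem1 (lam mu mus : ℝ) (hmu : 0 < mu) (hlam : 0 < lam + mu) (hmus : 0 < mus)
    (hne : mus ≠ mu) (P : ℝ) :
    -- horizontal force
    ((∀ k x, x ≠ 0 → (CubicGreen.uP1 lam mu mus P k x).im = 0) ∧
      CubicGreen.IsPointForceDisplacement lam mu mus ![P, 0]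
        (CubicGreen.realField (CubicGreen.uP1 lam mu mus P)) ∧
      ∀ v : CubicGreen.Displacement,
        CubicGreen.IsPointForceDisplacement lam mu mus ![P, 0] v ↔
          ∃ (c : Fin 2 → ℝ) (rot : ℝ), ∀ k x, x ≠ 0 →
            v k x = CubicGreen.realField (CubicGreen.uP1 lam mu mus P) k x
              + CubicGreen.rigid c rot k x) ∧
    -- vertical force
    ((∀ k x, x ≠ 0 → (CubicGreen.uP2 lam mu mus P k x).im = 0) ∧
      CubicGreen.IsPointForceDisplacement lam mu mus ![0, P]
        (CubicGreen.realField (CubicGreen.uP2 lam mu mus P)) ∧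
      ∀ v : CubicGreen.Displacement,
        CubicGreen.IsPointForceDisplacement lam mu mus ![0, P] v ↔
          ∃ (c : Fin 2 → ℝ) (rot : ℝ), ∀ k x, x ≠ 0 →
            v k x = CubicGreen.realField (CubicGreen.uP2 lam mu mus P) k x
              + CubicGreen.rigid c rot k x) := by
  have h : CubicGreen.Admissible lam mu mus := ⟨hmu, hlam, hmus, hne⟩
  exact ⟨⟨fun k x hx => h.im_uP1 P k hx, h.isPointForceDisplacement_uP1 P,
      (h.isPointForceDisplacement_uP1 P).iff_eq_add_rigid h⟩,
    fun k x hx => h.im_uP2 P k hx, h.isPointForceDisplacement_uP2 P,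
    (h.isPointForceDisplacement_uP2 P).iff_eq_add_rigid h⟩
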